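/- Let $m\ge 0$ and $c>0$. Let $V\in L^1(\mathbb R_+,\mathrm{Mat}(2,\mathbb C))$, $\mathbb R_+=(0,\infty)$, be Hermitian-valued (a.e.), and put $$v:=\frac1c\int_0^\infty\|V(x)\|\,dx ,$$ where $\|\cdot\|$ is the operator norm on $\mathbb C^2$. Assume that $v<\sqrt3/2$. For $\alpha\in\{0,\pi/2\}$ let $D_0+V$ be the Dirac operator $$\begin{pmatrix} mc^2 & -c\,\frac{d}{dx}\\ c\,\frac{d}{dx} & -mc^2\end{pmatrix}+V(x)$$ in $L^2(\mathbb R_+,\mathbb C^2)$ with the boundary condition $\psi_1(0)\cos\alpha-\psi_2(0)\sin\alpha=0$. Its domain consists of all $\psi\in L^2(\mathbb R_+,\mathbb C^2)$ that are locally absolutely continuous on $[0,\infty)$, satisfy the boundary condition, and for which $(D_0+V)\psi\in L^2(\mathbb R_+,\mathbb C^2)$; if $V$ is bounded, this is the operator sum of $D_0$ and $V$. Then: 1. If $\alpha=0$, $$\sigma(D_0+V)\subset\left(-\infty,-mc^2(1-2v^2)\right]\cup\left[mc^2\left(1-\frac{v^2}{1+\sqrt{1-v^2}}\right),\infty\right).$$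 2. If $\alpha=\pi/2$, $$\sigma(D_0+V)\subset\left(-\infty,-mc^2\left(1-\frac{v^2}{1+\sqrt{1-v^2}}\right)\right]\cup\left[mc^2(1-2v^2),\infty\right).$$ 3. If $m>0$, the two half-lines in each of these inclusions are disjoint, that is, $-mc^2(1-2v^2)<mc^2\left(1-\frac{v^2}{1+\sqrt{1-v^2}}\right)$; and if moreover $v>0$, the gap between them is asymmetric about $0$, with $mc^2(1-2v^2)<mc^2\left(1-\frac{v^2}{1+\sqrt{1-v^2}}\right)$. -/

import Mathlib

open MeasureTheory Set
open scoped Matrix.Norms.L2Operator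

noncomputable section

/-- The spinor space `ℂ²` with its Hermitian inner product. -/
abbrev Spinor : Type := EuclideanSpace ℂ (Fin 2)

/-- The Hilbert space `L²(ℝ₊, ℂ²)`, `ℝ₊ = (0, ∞)`. -/
abbrev HalfLineL2 : Type := Lp Spinor 2 (volume.restrict (Ioi (0 : ℝ)))

/-- A `2 × 2` matrix acting on a spinor. -/
abbrev matAct (A : Matrix (Fin 2) (Fin 2) ℂ) : Spinor →L[ℂ] Spinor :=
  Matrix.toEuclideanCLM (n := Fin 2) (𝕜 := ℂ) A

/-- `w` is the (locally integrable) derivative of the function `u`, which is absolutely continuous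
on every interval `[0, R]`: the function `u` is the indefinite integral of `w`. -/
structure IsLocACWithDeriv (u w : ℝ → Spinor) : Prop where
  intervalIntegrable : ∀ R : ℝ, 0 < R → IntervalIntegrable w volume 0 R
  eq_integral : ∀ x : ℝ, 0 ≤ x → u x = u 0 + ∫ y in (0 : ℝ)..x, w y

/-- The differential expression of `D₀ + V`, evaluated at a point `x`, for a function `u` with
derivative `w`:
`(m c² u₁ - c w₂, c w₁ - m c² u₂) + V(x) (u₁, u₂)`. -/
def diracExpr (m c : ℝ) (V : ℝ → Matrix (Fin 2) (Fin 2) ℂ) (u w : ℝ → Spinor) (x : ℝ) : Spinor :=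
  matAct !![0, -(c : ℂ); (c : ℂ), 0] (w x)
    + matAct !![((m * c ^ 2 : ℝ) : ℂ), 0; 0, -((m * c ^ 2 : ℝ) : ℂ)] (u x)
    + matAct (V x) (u x)

/-- The graph of the Dirac operator `D₀ + V` on the half-line with the boundary condition
`ψ₁(0) cos α - ψ₂(0) sin α = 0`: all pairs `(ψ, φ)` in `L² × L²` such that `ψ` has a locally
absolutely continuous representative `u` on `[0, ∞)` which satisfies the boundary condition and
`φ = (D₀ + V) u` almost everywhere. -/
def diracGraph (m c α : ℝ) (V : ℝ → Matrix (Fin 2) (Fin 2) ℂ) :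
    Submodule ℂ (HalfLineL2 × HalfLineL2) where
  carrier := {p | ∃ u w : ℝ → Spinor, IsLocACWithDeriv u w ∧
    p.1 =ᵐ[volume.restrict (Ioi (0 : ℝ))] u ∧
    u 0 0 * (Real.cos α : ℂ) - u 0 1 * (Real.sin α : ℂ) = 0 ∧
    p.2 =ᵐ[volume.restrict (Ioi (0 : ℝ))] diracExpr m c V u w}
  zero_mem' := by
    refine ⟨fun _ => 0, fun _ => 0, ⟨fun R _ => by simp, fun x _ => by simp⟩, ?_, by simp, ?_⟩
    · exact Lp.coeFn_zero _ _ _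
    · filter_upwards [Lp.coeFn_zero Spinor 2 (volume.restrict (Ioi (0 : ℝ)))] with x hx
      simpa [diracExpr] using hx
  add_mem' := by
    rintro p q ⟨u, w, huw, hu, hb, hφ⟩ ⟨u', w', huw', hu', hb', hφ'⟩
    refine ⟨fun x => u x + u' x, fun x => w x + w' x, ⟨fun R hR => ?_, fun x hx => ?_⟩, ?_, ?_, ?_⟩
    · exact (huw.intervalIntegrable R hR).add (huw'.intervalIntegrable R hR)
    · have h1 : IntervalIntegrable w volume 0 x := by
        rcases hx.eq_or_lt with rfl | h
        · simp
        · exact huw.intervalIntegrable x h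
      have h2 : IntervalIntegrable w' volume 0 x := by
        rcases hx.eq_or_lt with rfl | h
        · simp
        · exact huw'.intervalIntegrable x h
      rw [intervalIntegral.integral_add h1 h2, huw.eq_integral x hx, huw'.eq_integral x hx]
      abel
    · filter_upwards [Lp.coeFn_add p.1 q.1, hu, hu'] with x h h1 h2
      simp only [Prod.fst_add, h, Pi.add_apply, h1, h2]
    · simp only [PiLp.add_apply]
      linear_combination hb + hb'
    · filter_upwards [Lp.coeFn_add p.2 q.2, hφ, hφ'] with x h h1 h2
      simp only [Prod.snd_add, h, Pi.add_apply, h1, h2, diracExpr, map_add]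
      abel
  smul_mem' := by
    rintro a p ⟨u, w, huw, hu, hb, hφ⟩
    refine ⟨fun x => a • u x, fun x => a • w x, ⟨fun R hR => ?_, fun x hx => ?_⟩, ?_, ?_, ?_⟩
    · exact (huw.intervalIntegrable R hR).smul a
    · rw [intervalIntegral.integral_smul, huw.eq_integral x hx, smul_add]
    · filter_upwards [Lp.coeFn_smul a p.1, hu] with x h h1
      simp only [Prod.smul_fst, h, Pi.smul_apply, h1]
    · simp only [PiLp.smul_apply, smul_eq_mul]
      linear_combination a * hb
    · filter_upwards [Lp.coeFn_smul a p.2, hφ] with x h h1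
      simp only [Prod.smul_snd, h, Pi.smul_apply, h1, diracExpr, map_smul, smul_add]

/-- An a.e. vanishing locally absolutely continuous function vanishes on `(0, ∞)`, together with
its derivative (a.e.). -/
theorem IsLocACWithDeriv.ae_eq_zero {u w : ℝ → Spinor} (h : IsLocACWithDeriv u w)
    (hu : u =ᵐ[volume.restrict (Ioi (0 : ℝ))] fun _ => 0) :
    (∀ x, 0 < x → u x = 0) ∧ w =ᵐ[volume.restrict (Ioi (0 : ℝ))] fun _ => 0 := by
  have hcont : ∀ R : ℝ, 0 < R → ContinuousOn u (Icc 0 R) := by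
    intro R hR
    have h1 : ContinuousOn (fun x => u 0 + ∫ y in (0 : ℝ)..x, w y) (Icc 0 R) := by
      refine continuousOn_const.add ?_
      have := intervalIntegral.continuousOn_primitive_interval'
        (h.intervalIntegrable R hR) left_mem_uIcc
      rwa [uIcc_of_le hR.le] at this
    exact h1.congr fun x hx => h.eq_integral x hx.1
  have hzero : ∀ x, 0 < x → u x = 0 := by
    intro x hx
    have hsub : Ioo (0 : ℝ) (x + 1) ⊆ Ioi 0 := fun y hy => hy.1
    have hae : u =ᵐ[volume.restrict (Ioo (0 : ℝ) (x + 1))] fun _ => 0 :=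
      ae_restrict_of_ae_restrict_of_subset hsub hu
    exact Measure.eqOn_open_of_ae_eq hae isOpen_Ioo
      ((hcont (x + 1) (by linarith)).mono Ioo_subset_Icc_self) continuousOn_const
      ⟨hx, by linarith⟩
  refine ⟨hzero, ?_⟩
  have key : ∀ n : ℕ, ∀ᵐ x, x ∈ Ioo (0 : ℝ) (n + 1) → w x = 0 := by
    intro n
    have hn : (0 : ℝ) < n + 1 := by positivity
    filter_upwards [(h.intervalIntegrable _ hn).ae_hasDerivAt_integral] with x hx hx'
    have hd := hx (by rw [uIcc_of_le hn.le]; exact ⟨hx'.1.le, hx'.2.le⟩) 0 left_mem_uIcc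
    have hc : HasDerivAt (fun _ : ℝ => -u 0) (0 : Spinor) x := hasDerivAt_const _ _
    refine hd.unique (hc.congr_of_eventuallyEq ?_)
    filter_upwards [Ioi_mem_nhds hx'.1] with y hy
    have := h.eq_integral y (le_of_lt hy)
    rw [hzero y hy] at this
    exact (neg_eq_of_add_eq_zero_right this.symm).symm
  rw [Filter.EventuallyEq, ae_restrict_iff' measurableSet_Ioi]
  filter_upwards [ae_all_iff.2 key] with x hx hx0
  obtain ⟨n, hn⟩ := exists_nat_gt x
  exact hx n ⟨hx0, by linarith⟩

/-- `diracGraph` is the graph of an operator. -/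
theorem diracGraph_single_valued (m c α : ℝ) (V : ℝ → Matrix (Fin 2) (Fin 2) ℂ)
    (p : HalfLineL2 × HalfLineL2) (hp : p ∈ diracGraph m c α V) (hp1 : p.1 = 0) : p.2 = 0 := by
  obtain ⟨u, w, huw, hu, -, hφ⟩ := hp
  have hu0 : u =ᵐ[volume.restrict (Ioi (0 : ℝ))] fun _ => 0 := by
    rw [hp1] at hu
    exact hu.symm.trans (Lp.coeFn_zero _ _ _)
  obtain ⟨-, hw⟩ := huw.ae_eq_zero hu0
  rw [Lp.eq_zero_iff_ae_eq_zero]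
  filter_upwards [hφ, hu0, hw] with x h1 h2 h3
  simp [h1, diracExpr, h2, h3]

/-- The Dirac operator `D₀ + V` in `L²(ℝ₊, ℂ²)` with the boundary condition
`ψ₁(0) cos α - ψ₂(0) sin α = 0`, on its natural (maximal) domain: all locally absolutely continuous
`ψ ∈ L²` with `(D₀ + V) ψ ∈ L²` which satisfy the boundary condition. -/
def diracOperator (m c α : ℝ) (V : ℝ → Matrix (Fin 2) (Fin 2) ℂ) : HalfLineL2 →ₗ.[ℂ] HalfLineL2 :=
  (diracGraph m c α V).toLinearPMap

theorem diracOperator_graph (m c α : ℝ) (V : ℝ → Matrix (Fin 2) (Fin 2) ℂ) :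
    (diracOperator m c α V).graph = diracGraph m c α V :=
  Submodule.toLinearPMap_graph_eq _ (diracGraph_single_valued m c α V)

/-- Wherever `V ψ` is in `L²` (so everywhere if `V` is bounded), `diracOperator m c α V` is the
operator sum of the free operator `D₀` and of the multiplication by `V`: the function `ψ` lies in
one domain iff it lies in the other one, and `(D₀ + V) ψ = D₀ ψ + V ψ`. -/
theorem diracOperator_graph_add (m c α : ℝ) (V : ℝ → Matrix (Fin 2) (Fin 2) ℂ)
    (ψ φ χ : HalfLineL2)
    (hχ : χ =ᵐ[volume.restrict (Ioi (0 : ℝ))] fun x => matAct (V x) (ψ x)) :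
    (ψ, φ + χ) ∈ (diracOperator m c α V).graph ↔ (ψ, φ) ∈ (diracOperator m c α 0).graph := by
  rw [diracOperator_graph, diracOperator_graph]
  constructor
  · rintro ⟨u, w, huw, hu, hb, hφ⟩
    refine ⟨u, w, huw, hu, hb, ?_⟩
    filter_upwards [hφ, hu, hχ, Lp.coeFn_add φ χ] with x h1 h2 h3 h4
    rw [h4, Pi.add_apply, h3, h2, diracExpr] at h1
    simpa [diracExpr] using add_right_cancel h1
  · rintro ⟨u, w, huw, hu, hb, hφ⟩
    refine ⟨u, w, huw, hu, hb, ?_⟩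
    filter_upwards [hφ, hu, hχ, Lp.coeFn_add φ χ] with x h1 h2 h3 h4
    change (φ : ℝ → Spinor) x = _ at h1
    change ((φ + χ : HalfLineL2) : ℝ → Spinor) x = _
    rw [h4, Pi.add_apply, h3, h2, h1]
    simp [diracExpr]

/-- The resolvent set of a (possibly unbounded) operator `A` in a normed space `H`: all `z` such
that `A - z`, from the domain of `A` to `H`, is bijective with a bounded inverse `R`. -/
def opResolventSet {H : Type*} [NormedAddCommGroup H] [NormedSpace ℂ H] (A : H →ₗ.[ℂ] H) : Set ℂ :=
  {z | ∃ R : H →L[ℂ] H,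
    (∀ f : H, ∃ h : R f ∈ A.domain, A ⟨R f, h⟩ - z • R f = f) ∧
    ∀ ψ : A.domain, R (A ψ - z • (ψ : H)) = ψ}

/-- The spectrum of a (possibly unbounded) operator. -/
def opSpectrum {H : Type*} [NormedAddCommGroup H] [NormedSpace ℂ H] (A : H →ₗ.[ℂ] H) : Set ℂ :=
  (opResolventSet A)ᶜ

end

/-! Write `a = m c²` and `s = √(1 - v²)`. At a suitable `z`, the free operator has an explicit Green
function `G`: the product of the solution decaying at infinity and the solution satisfying the
boundary condition, divided by `c` times their Wronskian. Its norm is at most `K exp (-κ |x - y|)`,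
so it maps `L¹` to bounded functions with norm at most `K`. Multiplication by an integrable `V` need
not preserve `L²`, but `V u` is integrable for bounded `u`. The equation `u = G (f - V u)` is
therefore solved by contraction in the sup norm, for instance when `K c v < 1`. As `G` maps both
`L²` and `L¹` into `L²`, the solution lies in the domain, and `D₀ + V - z` is surjective
(`GreenData.exists_mem_diracGraph`).

Surjectivity is enough because the operator is symmetric: it forces injectivity, and the inverse is
bounded (`LinearPMap.Symmetric.mem_opResolventSet`). Nonreal `z` are reached from `z = i t`, where
`K = 2 / c` works while `κ → ∞`, so that the contraction holds for large `|t|` whatever the size of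
`V`.

For real `|x| < a`, the constant `K` decides the result. Apart from the factor `exp (-κ |x - y|)`,
the squared norm of `G` is a convex quadratic in `t = exp (-2 κ min(x, y))`, so its supremum sits at
an endpoint. Far from the boundary (`t = 0`) one gets `c² K² = a² / (a² - x²)`; at the boundary (`t
= 1`) one gets `2 a / (a - σ x)`, with `σ = -1` for `α = 0` and `σ = 1` for `α = π / 2`. Multiplied
by `v²`, both are less than `1` exactly when `|x| < a s` and `σ x < a (1 - 2 v²)`. Since `1 - 2 v² =
2 s² - 1 ≤ s`, the boundary shortens the gap on one side only, whence the asymmetry. The gap is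
nonempty when `(2 s - 1) (s + 1) > 0`, that is, when `v < √3 / 2`. -/

noncomputable section

/-! ### Locally absolutely continuous functions on the half-line -/

/-- A function with smaller oscillation than an absolutely continuous one is absolutely
continuous. -/
theorem AbsolutelyContinuousOnInterval.of_dist_le {X Y : Type*} [PseudoMetricSpace X]
    [PseudoMetricSpace Y] {f : ℝ → X} {g : ℝ → Y} {a b : ℝ}
    (hg : AbsolutelyContinuousOnInterval g a b)
    (h : ∀ x ∈ uIcc a b, ∀ y ∈ uIcc a b, dist (f x) (f y) ≤ dist (g x) (g y)) :
    AbsolutelyContinuousOnInterval f a b := by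
  refine squeeze_zero' ?_ ?_ hg
  · filter_upwards with E
    exact Finset.sum_nonneg fun _ _ => dist_nonneg
  · rw [Filter.eventually_inf_principal]
    filter_upwards with E hE
    exact Finset.sum_le_sum fun i hi => h _ (hE.1 i hi).1 _ (hE.1 i hi).2

/-- `u` is the indefinite integral of the locally integrable function `w` on `[0, ∞)`. -/
structure IsLocPrimitive {E : Type*} [NormedAddCommGroup E] [NormedSpace ℝ E]
    (u w : ℝ → E) : Prop where
  intervalIntegrable : ∀ R : ℝ, 0 ≤ R → IntervalIntegrable w volume 0 R
  eq_integral : ∀ x : ℝ, 0 ≤ x → u x = u 0 + ∫ y in (0 : ℝ)..x, w y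

theorem IsLocACWithDeriv.isLocPrimitive {u w : ℝ → Spinor} (h : IsLocACWithDeriv u w) :
    IsLocPrimitive u w := by
  refine ⟨fun R hR => ?_, h.eq_integral⟩
  rcases hR.eq_or_lt with rfl | hR
  · simp
  · exact h.intervalIntegrable R hR

theorem IsLocPrimitive.isLocACWithDeriv {u w : ℝ → Spinor} (h : IsLocPrimitive u w) :
    IsLocACWithDeriv u w :=
  ⟨fun R hR => h.intervalIntegrable R hR.le, h.eq_integral⟩

namespace IsLocPrimitive

variable {E F G : Type*} [NormedAddCommGroup E] [NormedSpace ℝ E]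
  [NormedAddCommGroup F] [NormedSpace ℝ F] [NormedAddCommGroup G] [NormedSpace ℝ G]

theorem intervalIntegrable' {u w : ℝ → E} (h : IsLocPrimitive u w) {x y : ℝ} (hx : 0 ≤ x)
    (hy : 0 ≤ y) : IntervalIntegrable w volume x y :=
  (h.intervalIntegrable x hx).symm.trans (h.intervalIntegrable y hy)

theorem sub_eq_integral {u w : ℝ → E} (h : IsLocPrimitive u w) {x y : ℝ} (hx : 0 ≤ x)
    (hy : 0 ≤ y) : u y - u x = ∫ t in x..y, w t := by
  rw [h.eq_integral y hy, h.eq_integral x hx, add_sub_add_left_eq_sub,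
    intervalIntegral.integral_interval_sub_left (h.intervalIntegrable y hy)
      (h.intervalIntegrable x hx)]

theorem continuousOn {u w : ℝ → E} (h : IsLocPrimitive u w) : ContinuousOn u (Ici 0) := by
  intro x hx
  have hR : (0 : ℝ) ≤ x + 1 := by linarith [mem_Ici.1 hx]
  have h1 : ContinuousOn (fun x => u 0 + ∫ y in (0 : ℝ)..x, w y) (Icc 0 (x + 1)) := by
    refine continuousOn_const.add ?_
    have := intervalIntegral.continuousOn_primitive_interval'
      (h.intervalIntegrable _ hR) left_mem_uIcc
    rwa [uIcc_of_le hR] at this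
  have h2 : ContinuousOn u (Icc 0 (x + 1)) := h1.congr fun y hy => h.eq_integral y hy.1
  refine (h2 x ⟨hx, by linarith⟩).mono_of_mem_nhdsWithin ?_
  rw [← Ici_inter_Iic]
  exact inter_mem_nhdsWithin _ (Iic_mem_nhds (by linarith))

theorem ae_hasDerivAt [CompleteSpace E] {u w : ℝ → E} (h : IsLocPrimitive u w) (R : ℝ)
    (hR : 0 ≤ R) : ∀ᵐ x, x ∈ Ioo (0 : ℝ) R → HasDerivAt u (w x) x := by
  filter_upwards [(h.intervalIntegrable R hR).ae_hasDerivAt_integral] with x hx hx'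
  have hd := hx (by rw [uIcc_of_le hR]; exact ⟨hx'.1.le, hx'.2.le⟩) 0 left_mem_uIcc
  refine (hd.const_add (u 0)).congr_of_eventuallyEq ?_
  filter_upwards [Ioi_mem_nhds hx'.1] with y hy
  exact h.eq_integral y (le_of_lt hy)

/-- A function on `[0, R]` whose increments are controlled by the integral of `g`, and with a.e.
derivative `f'`, is the integral of `f'`. -/
theorem sub_eq_integral_of_ae_hasDerivAt [CompleteSpace E] {f f' : ℝ → E} {g : ℝ → ℝ} {R : ℝ}
    (hR : 0 ≤ R) (hg : IntervalIntegrable g volume 0 R) (hf' : IntervalIntegrable f' volume 0 R)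
    (hdist : ∀ x ∈ Icc 0 R, ∀ y ∈ Icc x R, ‖f y - f x‖ ≤ ∫ t in x..y, g t)
    (hderiv : ∀ᵐ x, x ∈ Ioo (0 : ℝ) R → HasDerivAt f (f' x) x) :
    f R - f 0 = ∫ t in (0 : ℝ)..R, f' t := by
  have hsub : ∀ {x y : ℝ}, x ∈ Icc 0 R → y ∈ Icc 0 R → uIcc x y ⊆ uIcc 0 R := fun hx hy => by
    rw [← uIcc_of_le hR] at hx hy
    exact uIcc_subset_uIcc hx hy
  have hg0 : ∀ y ∈ Icc 0 R, IntervalIntegrable g volume 0 y := fun y hy =>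
    hg.mono_set (hsub ⟨le_rfl, hR⟩ hy)
  have hf0 : ∀ y ∈ Icc 0 R, IntervalIntegrable f' volume 0 y := fun y hy =>
    hf'.mono_set (hsub ⟨le_rfl, hR⟩ hy)
  have hG := hg.absolutelyContinuousOnInterval_intervalIntegral (c := 0) left_mem_uIcc
  have hN := hf'.norm.absolutelyContinuousOnInterval_intervalIntegral (c := 0) left_mem_uIcc
  have h1 : AbsolutelyContinuousOnInterval f 0 R := by
    refine hG.of_dist_le fun x hx y hy => ?_
    rw [uIcc_of_le hR] at hx hy
    wlog hxy : x ≤ y generalizing x y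
    · rw [dist_comm (f x), dist_comm (∫ v in (0 : ℝ)..x, g v)]
      exact this y hy x hx (le_of_not_ge hxy)
    rw [dist_comm, dist_comm (∫ v in (0 : ℝ)..x, g v), dist_eq_norm, Real.dist_eq,
      intervalIntegral.integral_interval_sub_left (hg0 y hy) (hg0 x hx)]
    exact (hdist x hx y ⟨hxy, hy.2⟩).trans (le_abs_self _)
  have h2 : AbsolutelyContinuousOnInterval (fun x => ∫ t in (0 : ℝ)..x, f' t) 0 R := by
    refine hN.of_dist_le fun x hx y hy => ?_
    rw [uIcc_of_le hR] at hx hy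
    rw [dist_eq_norm, Real.dist_eq,
      intervalIntegral.integral_interval_sub_left (hf0 x hx) (hf0 y hy),
      intervalIntegral.integral_interval_sub_left (hf0 x hx).norm (hf0 y hy).norm]
    exact intervalIntegral.norm_integral_le_abs_integral_norm
  have hends : ∀ᵐ x : ℝ, x ≠ 0 ∧ x ≠ R := by
    refine Filter.Eventually.and ?_ ?_ <;> simp [ae_iff]
  -- The difference of `f` and the primitive of `f'` is absolutely continuous with derivative zero
  -- a.e., hence constant; a zero derivative a.e. alone would not suffice.
  obtain ⟨C, hC⟩ := (h1.fun_sub h2).const_of_ae_hasDerivAt_zero (by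
    filter_upwards [hderiv, hf'.ae_hasDerivAt_integral, hends] with x hx1 hx2 hx3 hx
    have hx' := hx
    rw [uIcc_of_le hR] at hx'
    have := (hx1 ⟨lt_of_le_of_ne hx'.1 (Ne.symm hx3.1), lt_of_le_of_ne hx'.2 hx3.2⟩).sub
      (hx2 hx 0 left_mem_uIcc)
    rwa [sub_self] at this)
  have e0 := hC 0 left_mem_uIcc
  have eR := hC R right_mem_uIcc
  simp only [intervalIntegral.integral_same, sub_zero] at e0
  rw [e0, ← eR]
  abel

/-- The product rule. -/
theorem bilinear [CompleteSpace E] [CompleteSpace F] [CompleteSpace G] {u w : ℝ → E}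
    {v z : ℝ → F} {b : E × F → G} (hb : IsBoundedBilinearMap ℝ b)
    (hu : IsLocPrimitive u w) (hv : IsLocPrimitive v z) :
    IsLocPrimitive (fun x => b (u x, v x)) (fun x => b (u x, z x) + b (w x, v x)) := by
  have hint : ∀ R : ℝ, 0 ≤ R →
      IntervalIntegrable (fun x => b (u x, z x) + b (w x, v x)) volume 0 R := by
    obtain ⟨C, hC0, hC⟩ := hb.bound
    intro R hR
    have huc : ContinuousOn u (Icc 0 R) := hu.continuousOn.mono Icc_subset_Ici_self
    have hvc : ContinuousOn v (Icc 0 R) := hv.continuousOn.mono Icc_subset_Ici_self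
    obtain ⟨M, hM⟩ := isCompact_Icc.exists_bound_of_continuousOn huc
    obtain ⟨N, hN⟩ := isCompact_Icc.exists_bound_of_continuousOn hvc
    have hum := (huc.mono Ioc_subset_Icc_self).aestronglyMeasurable (μ := volume) measurableSet_Ioc
    have hvm := (hvc.mono Ioc_subset_Icc_self).aestronglyMeasurable (μ := volume) measurableSet_Ioc
    have hw := (intervalIntegrable_iff_integrableOn_Ioc_of_le hR).1 (hu.intervalIntegrable R hR)
    have hz := (intervalIntegrable_iff_integrableOn_Ioc_of_le hR).1 (hv.intervalIntegrable R hR)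
    rw [intervalIntegrable_iff_integrableOn_Ioc_of_le hR]
    refine Integrable.add ?_ ?_
    · refine (hz.norm.const_mul (C * M)).mono'
        (hb.continuous.comp_aestronglyMeasurable (hum.prodMk hz.aestronglyMeasurable)) ?_
      filter_upwards [ae_restrict_mem measurableSet_Ioc] with x hx
      refine (hC _ _).trans ?_
      gcongr
      exact hM x (Ioc_subset_Icc_self hx)
    · refine (hw.norm.const_mul (C * N)).mono'
        (hb.continuous.comp_aestronglyMeasurable (hw.aestronglyMeasurable.prodMk hvm)) ?_
      filter_upwards [ae_restrict_mem measurableSet_Ioc] with x hx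
      refine (hC _ _).trans ?_
      rw [mul_right_comm]
      gcongr
      exact hN x (Ioc_subset_Icc_self hx)
  refine ⟨hint, fun R hR => ?_⟩
  obtain ⟨C, hC0, hC⟩ := hb.bound
  obtain ⟨M, hM⟩ := isCompact_Icc.exists_bound_of_continuousOn
    (hu.continuousOn.mono (Icc_subset_Ici_self : Icc 0 R ⊆ Ici 0))
  obtain ⟨N, hN⟩ := isCompact_Icc.exists_bound_of_continuousOn
    (hv.continuousOn.mono (Icc_subset_Ici_self : Icc 0 R ⊆ Ici 0))
  have hR0 : (0 : ℝ) ∈ Icc 0 R := ⟨le_rfl, hR⟩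
  rw [← sub_eq_iff_eq_add']
  refine sub_eq_integral_of_ae_hasDerivAt hR (f := fun x => b (u x, v x))
    (g := fun t => C * M * ‖z t‖ + C * N * ‖w t‖)
    (((hv.intervalIntegrable R hR).norm.const_mul _).add
      ((hu.intervalIntegrable R hR).norm.const_mul _)) (hint R hR) ?_ ?_
  · intro x hx y hy
    have hy0 : 0 ≤ y := hx.1.trans hy.1
    -- Changing one argument at a time bounds the increment by the integral of `C M ‖z‖ + C N ‖w‖`.
    have e : b (u y, v y) - b (u x, v x) = b (u y, v y - v x) + b (u y - u x, v x) := by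
      rw [hb.map_sub_right, hb.map_sub_left]
      abel
    rw [e, hv.sub_eq_integral hx.1 hy0, hu.sub_eq_integral hx.1 hy0,
      intervalIntegral.integral_add ((hv.intervalIntegrable' hx.1 hy0).norm.const_mul _)
        ((hu.intervalIntegrable' hx.1 hy0).norm.const_mul _),
      intervalIntegral.integral_const_mul, intervalIntegral.integral_const_mul]
    refine (norm_add_le _ _).trans (add_le_add ?_ ?_)
    · refine (hC _ _).trans ?_
      gcongr
      · exact mul_nonneg hC0.le ((norm_nonneg _).trans (hM 0 hR0))
      · exact hM y ⟨hy0, hy.2⟩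
      · exact intervalIntegral.norm_integral_le_integral_norm hy.1
    · refine (hC _ _).trans ?_
      rw [mul_right_comm]
      gcongr
      · exact mul_nonneg hC0.le ((norm_nonneg _).trans (hN 0 hR0))
      · exact hN x hx
      · exact intervalIntegral.norm_integral_le_integral_norm hy.1
  · filter_upwards [hu.ae_hasDerivAt R hR, hv.ae_hasDerivAt R hR] with x h1 h2 hx
    have h3 := (hb.hasFDerivAt (u x, v x)).comp_hasDerivAt x ((h1 hx).prodMk (h2 hx))
    simpa [Function.comp_def] using h3

theorem add {u w v z : ℝ → E} (hu : IsLocPrimitive u w) (hv : IsLocPrimitive v z) :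
    IsLocPrimitive (fun x => u x + v x) (fun x => w x + z x) := by
  refine ⟨fun R hR => (hu.intervalIntegrable R hR).add (hv.intervalIntegrable R hR),
    fun x hx => ?_⟩
  rw [intervalIntegral.integral_add (hu.intervalIntegrable x hx) (hv.intervalIntegrable x hx),
    hu.eq_integral x hx, hv.eq_integral x hx]
  abel

theorem of_hasDerivAt [CompleteSpace E] {u w : ℝ → E} (h : ∀ x, HasDerivAt u (w x) x)
    (hw : Continuous w) :
    IsLocPrimitive u w := by
  refine ⟨fun R _ => hw.intervalIntegrable _ _, fun x _ => ?_⟩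
  rw [intervalIntegral.integral_eq_sub_of_hasDerivAt (fun y _ => h y) (hw.intervalIntegrable _ _)]
  abel

/-- The image under a bounded linear map. -/
theorem clm_apply [CompleteSpace E] [CompleteSpace F] {u w : ℝ → E} (h : IsLocPrimitive u w)
    (A : E →L[ℝ] F) :
    IsLocPrimitive (fun x => A (u x)) (fun x => A (w x)) := by
  refine ⟨fun R hR => ?_, fun x hx => ?_⟩
  · have := h.intervalIntegrable R hR
    exact ⟨A.integrable_comp this.1, A.integrable_comp this.2⟩
  · rw [h.eq_integral x hx, map_add, A.intervalIntegral_comp_comm (h.intervalIntegrable x hx)]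

end IsLocPrimitive

/-! ### Exponential kernels -/

/-- The kernel `exp (-κ |x - y|)`, with values in `[0, ∞]`. -/
def expKernel (κ x y : ℝ) : ENNReal := ENNReal.ofReal (Real.exp (-κ * |x - y|))

theorem measurable_expKernel (κ : ℝ) : Measurable (Function.uncurry (expKernel κ)) := by
  unfold expKernel Function.uncurry
  fun_prop

theorem expKernel_comm (κ x y : ℝ) : expKernel κ x y = expKernel κ y x := by
  rw [expKernel, expKernel, abs_sub_comm]

theorem expKernel_le_one {κ : ℝ} (hκ : 0 < κ) (x y : ℝ) : expKernel κ x y ≤ 1 := by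
  rw [expKernel, ENNReal.ofReal_le_one, Real.exp_le_one_iff]
  nlinarith [abs_nonneg (x - y)]

theorem integral_exp_neg_mul_abs_sub {κ : ℝ} (hκ : 0 < κ) (x : ℝ) :
    ∫ y : ℝ, Real.exp (-κ * |x - y|) = 2 / κ := by
  rw [integral_sub_left_eq_self (fun y : ℝ => Real.exp (-κ * |y|)) volume x]
  rw [integral_comp_abs (f := fun t : ℝ => Real.exp (-κ * t)),
    integral_exp_mul_Ioi (by linarith) 0]
  field_simp
  simp

theorem integrable_exp_neg_mul_abs_sub {κ : ℝ} (hκ : 0 < κ) (x : ℝ) :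
    Integrable (fun y : ℝ => Real.exp (-κ * |x - y|)) := by
  -- The Bochner integral of a nonintegrable function is `0` by convention, so a nonzero value
  -- proves integrability.
  refine .of_integral_ne_zero ?_
  rw [integral_exp_neg_mul_abs_sub hκ]
  positivity

theorem lintegral_expKernel_le {κ : ℝ} (hκ : 0 < κ) (x : ℝ) (s : Set ℝ) :
    ∫⁻ y in s, expKernel κ x y ≤ ENNReal.ofReal (2 / κ) := by
  refine (setLIntegral_le_lintegral s _).trans ?_
  rw [← integral_exp_neg_mul_abs_sub hκ x, ofReal_integral_eq_lintegral_ofReal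
    (integrable_exp_neg_mul_abs_sub hκ x) (.of_forall fun y => (Real.exp_pos _).le)]
  exact le_rfl

/-- Weighted Cauchy-Schwarz inequality. -/
theorem lintegral_mul_sq_le {α : Type*} [MeasurableSpace α] {μ : Measure α} {k φ : α → ENNReal}
    (hk : AEMeasurable k μ) (hφ : AEMeasurable φ μ) :
    (∫⁻ y, k y * φ y ∂μ) ^ 2 ≤ (∫⁻ y, k y ∂μ) * ∫⁻ y, k y * φ y ^ 2 ∂μ := by
  have h := ENNReal.lintegral_mul_le_Lp_mul_Lq μ (p := 2) (q := 2)
    (Real.HolderConjugate.two_two) (f := fun y => k y ^ (1 / 2 : ℝ))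
    (g := fun y => k y ^ (1 / 2 : ℝ) * φ y) (hk.pow_const _) ((hk.pow_const _).mul hφ)
  have e1 : ∀ y, k y ^ (1 / 2 : ℝ) * k y ^ (1 / 2 : ℝ) = k y := fun y => by
    rw [← ENNReal.rpow_add_of_nonneg _ _ (by norm_num) (by norm_num)]
    norm_num
  have e2 : ∀ y, (k y ^ (1 / 2 : ℝ)) ^ (2 : ℝ) = k y := fun y => by
    rw [← ENNReal.rpow_mul]
    norm_num
  simp only [Pi.mul_apply, ← mul_assoc, e1, e2, ENNReal.mul_rpow_of_nonneg _ _ zero_le_two] at h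
  calc _ ≤ ((∫⁻ y, k y ∂μ) ^ (1 / 2 : ℝ) * (∫⁻ y, k y * φ y ^ (2 : ℝ) ∂μ) ^ (1 / 2 : ℝ)) ^ 2 := by
        gcongr
    _ = _ := by
        rw [mul_pow]
        simp only [← ENNReal.rpow_natCast, ← ENNReal.rpow_mul]
        norm_num

theorem lintegral_lintegral_expKernel_mul_le {κ : ℝ} (hκ : 0 < κ) {s : Set ℝ}
    {φ : ℝ → ENNReal} (hφ : AEMeasurable φ (volume.restrict s)) :
    ∫⁻ x in s, ∫⁻ y in s, expKernel κ x y * φ y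
      ≤ ENNReal.ofReal (2 / κ) * ∫⁻ y in s, φ y := by
  have hm := measurable_expKernel κ
  rw [lintegral_lintegral_swap]
  · rw [← lintegral_const_mul'' _ hφ]
    refine lintegral_mono fun y => ?_
    have hmy : Measurable fun x => expKernel κ x y :=
      hm.comp (measurable_id.prodMk measurable_const)
    rw [lintegral_mul_const _ hmy]
    gcongr
    simp_rw [expKernel_comm κ _ y]
    exact lintegral_expKernel_le hκ y s
  · exact hm.aemeasurable.mul hφ.comp_snd

/-- Schur's test for the exponential kernel. -/
theorem lintegral_sq_lintegral_expKernel_mul_le {κ : ℝ} (hκ : 0 < κ) {s : Set ℝ}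
    {φ : ℝ → ENNReal} (hφ : AEMeasurable φ (volume.restrict s)) :
    ∫⁻ x in s, (∫⁻ y in s, expKernel κ x y * φ y) ^ 2
      ≤ ENNReal.ofReal (2 / κ) ^ 2 * ∫⁻ y in s, φ y ^ 2 := by
  have hm : ∀ x, AEMeasurable (expKernel κ x) (volume.restrict s) := fun x =>
    ((measurable_expKernel κ).comp (measurable_const.prodMk measurable_id)).aemeasurable
  calc _ ≤ ∫⁻ x in s, ENNReal.ofReal (2 / κ) * ∫⁻ y in s, expKernel κ x y * φ y ^ 2 := by
        refine lintegral_mono fun x => (lintegral_mul_sq_le (hm x) hφ).trans ?_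
        gcongr
        exact lintegral_expKernel_le hκ x s
    _ = ENNReal.ofReal (2 / κ) * ∫⁻ x in s, ∫⁻ y in s, expKernel κ x y * φ y ^ 2 :=
        lintegral_const_mul' _ _ ENNReal.ofReal_ne_top
    _ ≤ ENNReal.ofReal (2 / κ) * (ENNReal.ofReal (2 / κ) * ∫⁻ y in s, φ y ^ 2) := by
        gcongr
        exact lintegral_lintegral_expKernel_mul_le hκ (hφ.pow_const 2)
    _ = _ := by ring

/-- One factor of the square is at most `∫ φ`, because the kernel is at most `1`; Tonelli integrates
the other. This is the `L¹ → L²` bound needed for the term `V u`. -/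
theorem lintegral_sq_lintegral_expKernel_mul_le' {κ : ℝ} (hκ : 0 < κ) {s : Set ℝ}
    {φ : ℝ → ENNReal} (hφ : AEMeasurable φ (volume.restrict s)) (hfin : ∫⁻ y in s, φ y ≠ ⊤) :
    ∫⁻ x in s, (∫⁻ y in s, expKernel κ x y * φ y) ^ 2
      ≤ ENNReal.ofReal (2 / κ) * (∫⁻ y in s, φ y) ^ 2 := by
  calc _ ≤ ∫⁻ x in s, (∫⁻ y in s, φ y) * ∫⁻ y in s, expKernel κ x y * φ y := by
        refine lintegral_mono fun x => ?_
        rw [sq]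
        gcongr with y
        exact mul_le_of_le_one_left' (expKernel_le_one hκ x y)
    _ = (∫⁻ y in s, φ y) * ∫⁻ x in s, ∫⁻ y in s, expKernel κ x y * φ y :=
        lintegral_const_mul' _ _ hfin
    _ ≤ (∫⁻ y in s, φ y) * (ENNReal.ofReal (2 / κ) * ∫⁻ y in s, φ y) := by
        gcongr
        exact lintegral_lintegral_expKernel_mul_le hκ hφ
    _ = _ := by ring

theorem integrableOn_exp_mul_of_integrableOn {κ : ℝ} (hκ : 0 < κ) {s : Set ℝ} {φ : ℝ → ℝ}
    (hφ : IntegrableOn φ s) (x : ℝ) :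
    IntegrableOn (fun y => Real.exp (-κ * |x - y|) * φ y) s := by
  refine Integrable.bdd_mul (c := 1) hφ (by fun_prop) (.of_forall fun y => ?_)
  rw [Real.norm_eq_abs, Real.abs_exp, Real.exp_le_one_iff]
  nlinarith [abs_nonneg (x - y)]

theorem setIntegral_exp_mul_le {κ : ℝ} (hκ : 0 < κ) {s : Set ℝ} {φ : ℝ → ℝ}
    (hφ : IntegrableOn φ s) (h0 : ∀ y, 0 ≤ φ y) (x : ℝ) :
    ∫ y in s, Real.exp (-κ * |x - y|) * φ y ≤ ∫ y in s, φ y := by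
  refine integral_mono (integrableOn_exp_mul_of_integrableOn hκ hφ x) hφ fun y => ?_
  refine mul_le_of_le_one_left (h0 y) ?_
  rw [Real.exp_le_one_iff]
  nlinarith [abs_nonneg (x - y)]

/-- The convolution of an integrable function with `exp (-κ |x|)` is uniformly small for
large `κ`. -/
theorem exists_forall_setIntegral_exp_mul_le {s : Set ℝ} {φ : ℝ → ℝ}
    (hφ : IntegrableOn φ s) (h0 : ∀ y, 0 ≤ φ y) {ε : ℝ} (hε : 0 < ε) :
    ∃ κ₀ : ℝ, 0 < κ₀ ∧ ∀ κ, κ₀ ≤ κ → ∀ x : ℝ,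
      ∫ y in s, Real.exp (-κ * |x - y|) * φ y ≤ ε := by
  -- Truncation at height `n`: the excess is small in `L¹`, and the truncated part contributes at
  -- most `2 n / κ`.
  have hlim : Filter.Tendsto (fun n : ℕ => ∫ y in s, (φ y - min (φ y) n)) Filter.atTop
      (nhds (∫ y in s, (0 : ℝ))) := by
    refine tendsto_integral_of_dominated_convergence φ (fun n => ?_) hφ (fun n => ?_) ?_
    · exact hφ.aestronglyMeasurable.sub
        (hφ.aestronglyMeasurable.inf aestronglyMeasurable_const)
    · refine .of_forall fun y => ?_
      have h1 : 0 ≤ min (φ y) (n : ℝ) := le_min (h0 y) (Nat.cast_nonneg n)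
      rw [Real.norm_eq_abs, abs_of_nonneg (sub_nonneg.2 (min_le_left _ _))]
      linarith
    · refine .of_forall fun y => ?_
      obtain ⟨N, hN⟩ := exists_nat_ge (φ y)
      refine tendsto_const_nhds.congr' ?_
      filter_upwards [Filter.eventually_ge_atTop N] with n hn
      rw [min_eq_left (hN.trans (by exact_mod_cast hn)), sub_self]
  rw [integral_zero] at hlim
  obtain ⟨n, hn⟩ := (hlim.eventually_lt_const (half_pos hε)).exists
  have hmin : IntegrableOn (fun y => φ y - min (φ y) n) s := by
    refine Integrable.mono' hφ (hφ.aestronglyMeasurable.sub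
      (hφ.aestronglyMeasurable.inf aestronglyMeasurable_const)) (.of_forall fun y => ?_)
    have h1 : 0 ≤ min (φ y) (n : ℝ) := le_min (h0 y) (Nat.cast_nonneg n)
    rw [Real.norm_eq_abs, abs_of_nonneg (sub_nonneg.2 (min_le_left _ _))]
    linarith
  refine ⟨4 * (n + 1) / ε, by positivity, fun κ hκ x => ?_⟩
  have hκ0 : 0 < κ := lt_of_lt_of_le (by positivity) hκ
  have hexp := (integrable_exp_neg_mul_abs_sub hκ0 x)
  calc ∫ y in s, Real.exp (-κ * |x - y|) * φ y
      ≤ ∫ y in s, (Real.exp (-κ * |x - y|) * (φ y - min (φ y) n)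
          + Real.exp (-κ * |x - y|) * n) := by
        refine integral_mono (integrableOn_exp_mul_of_integrableOn hκ0 hφ x)
          ((integrableOn_exp_mul_of_integrableOn hκ0 hmin x).add
            (hexp.mul_const _).integrableOn) fun y => ?_
        have := mul_le_mul_of_nonneg_left (min_le_right (φ y) (n : ℝ))
          (Real.exp_pos (-κ * |x - y|)).le
        simp only
        nlinarith
    _ = (∫ y in s, Real.exp (-κ * |x - y|) * (φ y - min (φ y) n))
          + (∫ y in s, Real.exp (-κ * |x - y|)) * n := by
        rw [integral_add (integrableOn_exp_mul_of_integrableOn hκ0 hmin x)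
          (hexp.mul_const _).integrableOn, integral_mul_const]
    _ ≤ ε / 2 + 2 / κ * n := by
        gcongr
        · exact (setIntegral_exp_mul_le hκ0 hmin
            (fun y => sub_nonneg.2 (min_le_left _ _)) x).trans hn.le
        · rw [← integral_exp_neg_mul_abs_sub hκ0 x]
          exact setIntegral_le_integral hexp (.of_forall fun y => (Real.exp_pos _).le)
    _ ≤ ε := by
        rw [div_le_iff₀ hε] at hκ
        have : 2 / κ * n ≤ ε / 2 := by
          rw [div_mul_eq_mul_div, div_le_iff₀ hκ0]
          nlinarith
        linarith

/-! ### The Green function of the free Dirac operator -/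

/-- The bilinear pairing `s₁ h₁ + s₂ h₂` of two spinors. -/
def spinorPair (s : Spinor) : Spinor →L[ℂ] ℂ :=
  s 0 • EuclideanSpace.proj (𝕜 := ℂ) (0 : Fin 2) + s 1 • EuclideanSpace.proj (𝕜 := ℂ) (1 : Fin 2)

theorem spinorPair_apply (s h : Spinor) : spinorPair s h = s 0 * h 0 + s 1 * h 1 := by
  simp [spinorPair]

theorem norm_spinorPair_le (s h : Spinor) : ‖spinorPair s h‖ ≤ ‖s‖ * ‖h‖ := by
  -- Conjugating `s` turns the bilinear pairing into the inner product, so Cauchy-Schwarz applies.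
  have e : ‖(!₂[starRingEnd ℂ (s 0), starRingEnd ℂ (s 1)] : Spinor)‖ = ‖s‖ := by
    simp [EuclideanSpace.norm_eq, Fin.sum_univ_two]
  have h1 := norm_inner_le_norm (𝕜 := ℂ)
    (!₂[starRingEnd ℂ (s 0), starRingEnd ℂ (s 1)] : Spinor) h
  rw [e] at h1
  refine le_trans (le_of_eq ?_) h1
  congr 1
  rw [spinorPair_apply, PiLp.inner_apply, Fin.sum_univ_two]
  simp [mul_comm]

/-- The decaying solution of the free Dirac equation. -/
def decaySpinor (κ : ℝ) (η : ℂ) (x : ℝ) : Spinor :=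
  Real.exp (-κ * x) • (!₂[1, -η] : Spinor)

/-- The solution of the free Dirac equation which satisfies the boundary condition. -/
def regSpinor (κ : ℝ) (η : ℂ) (σ : ℝ) (x : ℝ) : Spinor :=
  Real.exp (κ * x) • (!₂[1, η] : Spinor) + Real.exp (-κ * x) • (!₂[(σ : ℂ), -(σ * η)] : Spinor)

/-- The action of the Green function on `h`. -/
def greenFun (c κ : ℝ) (η : ℂ) (σ : ℝ) (h : ℝ → Spinor) (x : ℝ) : Spinor :=
  -- Up to sign, `2 η` is the determinant of the two solutions, which does not depend on `x`.
  (2 * η * c)⁻¹ • ((∫ y in Ioi x, spinorPair (decaySpinor κ η y) (h y)) • regSpinor κ η σ x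
    + (∫ y in (0 : ℝ)..x, spinorPair (regSpinor κ η σ y) (h y)) • decaySpinor κ η x)

/-- The parameters of the Green function at the spectral parameter `z`: the decay rate `κ`, the
ratio `η` of the two components of the solutions, the parameter `σ` of the boundary condition, and
a bound `K` of the Green function. -/
structure GreenData (m c : ℝ) (z : ℂ) (κ : ℝ) (η : ℂ) (σ K : ℝ) : Prop where
  c_pos : 0 < c
  κ_pos : 0 < κ
  K_nonneg : 0 ≤ K
  η_ne_zero : η ≠ 0
  -- This and `mul_sub` are the two rows of the free equation for `exp (κ x) (1, η)` and `exp (-κ x)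
  -- (1, -η)`.
  mul_add : (c : ℂ) * κ = η * ((m * c ^ 2 : ℝ) + z)
  mul_sub : (c : ℂ) * κ * η = (m * c ^ 2 : ℝ) - z
  -- Here `t` stands for `exp (-2 κ x)`, where `x` is the argument of `regSpinor`.
  norm_mul_norm_le : ∀ t ∈ Icc (0 : ℝ) 1,
    ‖(!₂[1, -η] : Spinor)‖ * ‖(!₂[1 + σ * t, η * (1 - σ * t)] : Spinor)‖ ≤ 2 * ‖η‖ * c * K

theorem hasDerivAt_decaySpinor (κ : ℝ) (η : ℂ) (x : ℝ) :
    HasDerivAt (decaySpinor κ η) (-κ • decaySpinor κ η x) x := by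
  have h : HasDerivAt (fun x : ℝ => Real.exp (-κ * x)) (Real.exp (-κ * x) * -κ) x := by
    simpa using ((hasDerivAt_id x).const_mul (-κ)).exp
  refine (h.smul_const (!₂[1, -η] : Spinor)).congr_deriv ?_
  rw [decaySpinor, smul_smul, mul_comm]

theorem hasDerivAt_regSpinor (κ : ℝ) (η : ℂ) (σ x : ℝ) :
    HasDerivAt (regSpinor κ η σ) (κ • (Real.exp (κ * x) • (!₂[1, η] : Spinor)
      - Real.exp (-κ * x) • (!₂[(σ : ℂ), -(σ * η)] : Spinor))) x := by
  have h : HasDerivAt (fun x : ℝ => Real.exp (κ * x)) (Real.exp (κ * x) * κ) x := by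
    simpa using ((hasDerivAt_id x).const_mul κ).exp
  have h' : HasDerivAt (fun x : ℝ => Real.exp (-κ * x)) (Real.exp (-κ * x) * -κ) x := by
    simpa using ((hasDerivAt_id x).const_mul (-κ)).exp
  refine ((h.smul_const (!₂[1, η] : Spinor)).add
    (h'.smul_const (!₂[(σ : ℂ), -(σ * η)] : Spinor))).congr_deriv ?_
  rw [smul_sub, smul_smul, smul_smul, sub_eq_add_neg, ← neg_smul]
  congr 2 <;> ring

theorem continuous_decaySpinor (κ : ℝ) (η : ℂ) : Continuous (decaySpinor κ η) :=
  continuous_iff_continuousAt.2 fun x => (hasDerivAt_decaySpinor κ η x).continuousAt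

section

variable {κ : ℝ} {h : ℝ → Spinor}

/-- Integrability of `exp (-κ y) h y` follows from `h ∈ L²` as well as from `h ∈ L¹`; under it the
Green function acts on `f` and `V u` alike. -/
theorem integrableOn_spinorPair_decaySpinor
    (hh : IntegrableOn (fun y => Real.exp (-κ * y) • h y) (Ioi 0)) (η : ℂ) :
    IntegrableOn (fun y => spinorPair (decaySpinor κ η y) (h y)) (Ioi 0) := by
  refine ((spinorPair !₂[1, -η]).integrable_comp hh).congr (.of_forall fun y => ?_)
  simp [spinorPair_apply, decaySpinor]
  ring

theorem intervalIntegrable_spinorPair_regSpinor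
    (hh : IntegrableOn (fun y => Real.exp (-κ * y) • h y) (Ioi 0)) (η : ℂ) (σ : ℝ) {R : ℝ}
    (hR : 0 ≤ R) :
    IntervalIntegrable (fun y => spinorPair (regSpinor κ η σ y) (h y)) volume 0 R := by
  have hsub : IntegrableOn (fun y => Real.exp (-κ * y) • h y) (Ioc 0 R) :=
    hh.mono_set Ioc_subset_Ioi_self
  have h1 := (intervalIntegrable_iff_integrableOn_Ioc_of_le hR).2
    ((spinorPair !₂[1, η]).integrable_comp hsub)
  have h2 := (intervalIntegrable_iff_integrableOn_Ioc_of_le hR).2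
    ((spinorPair !₂[(σ : ℂ), -(σ * η)]).integrable_comp hsub)
  -- The growing part `exp (κ y)` is `exp (2 κ y) exp (-κ y)`, and the first factor is bounded on
  -- `[0, R]`.
  have h3 := (h1.continuousOn_mul (g := fun y => ((Real.exp (2 * κ * y) : ℝ) : ℂ))
    (by fun_prop)).add h2
  refine h3.congr fun y _ => ?_
  have e : (Complex.exp (2 * κ * y)) * Complex.exp (-(κ * y)) = Complex.exp (κ * y) := by
    rw [← Complex.exp_add]
    ring_nf
  simp [spinorPair_apply, regSpinor]
  linear_combination (h y 0 + η * h y 1) * e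

/-- The derivative of `greenFun`. -/
def greenDeriv (c κ : ℝ) (η : ℂ) (σ : ℝ) (h : ℝ → Spinor) (x : ℝ) : Spinor :=
  (2 * η * c)⁻¹ •
    (((∫ y in Ioi x, spinorPair (decaySpinor κ η y) (h y)) •
        (κ • (Real.exp (κ * x) • (!₂[1, η] : Spinor)
          - Real.exp (-κ * x) • (!₂[(σ : ℂ), -(σ * η)] : Spinor)))
      + (-spinorPair (decaySpinor κ η x) (h x)) • regSpinor κ η σ x)
    + ((∫ y in (0 : ℝ)..x, spinorPair (regSpinor κ η σ y) (h y)) • (-κ • decaySpinor κ η x)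
      + spinorPair (regSpinor κ η σ x) (h x) • decaySpinor κ η x))

/-- Variation of constants: each term is a scalar primitive times a smooth solution, so the product
rule applies. -/
theorem isLocPrimitive_greenFun
    (hh : IntegrableOn (fun y => Real.exp (-κ * y) • h y) (Ioi 0)) (c : ℝ) (η : ℂ) (σ : ℝ) :
    IsLocPrimitive (greenFun c κ η σ h) (greenDeriv c κ η σ h) := by
  have hd := integrableOn_spinorPair_decaySpinor hh η
  have hb : IsBoundedBilinearMap ℝ (fun p : ℂ × Spinor => p.1 • p.2) := isBoundedBilinearMap_smul
  have hα : IsLocPrimitive (fun x => ∫ y in Ioi x, spinorPair (decaySpinor κ η y) (h y))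
      (fun x => -spinorPair (decaySpinor κ η x) (h x)) := by
    have hi : ∀ R : ℝ, 0 ≤ R →
        IntervalIntegrable (fun x => spinorPair (decaySpinor κ η x) (h x)) volume 0 R :=
      fun R hR => (intervalIntegrable_iff_integrableOn_Ioc_of_le hR).2
        (hd.mono_set Ioc_subset_Ioi_self)
    refine ⟨fun R hR => (hi R hR).neg, fun x hx => ?_⟩
    rw [intervalIntegral.integral_neg, intervalIntegral.integral_of_le hx,
      ← Ioc_union_Ioi_eq_Ioi hx, setIntegral_union Ioc_disjoint_Ioi_same measurableSet_Ioi
        (hd.mono_set Ioc_subset_Ioi_self) (hd.mono_set (Ioi_subset_Ioi hx))]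
    ring
  have hβ : IsLocPrimitive (fun x => ∫ y in (0 : ℝ)..x, spinorPair (regSpinor κ η σ y) (h y))
      (fun x => spinorPair (regSpinor κ η σ x) (h x)) :=
    ⟨fun R hR => intervalIntegrable_spinorPair_regSpinor hh η σ hR, fun x _ => by simp⟩
  have hp : IsLocPrimitive (regSpinor κ η σ) _ :=
    IsLocPrimitive.of_hasDerivAt (hasDerivAt_regSpinor κ η σ) (by fun_prop)
  have hq : IsLocPrimitive (decaySpinor κ η) _ :=
    IsLocPrimitive.of_hasDerivAt (hasDerivAt_decaySpinor κ η)
      ((continuous_decaySpinor κ η).const_smul (-κ))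
  exact ((hα.bilinear hb hp).add (hβ.bilinear hb hq)).clm_apply
    (((2 * η * c)⁻¹ • ContinuousLinearMap.id ℂ Spinor).restrictScalars ℝ)

theorem greenFun_sub {h' : ℝ → Spinor}
    (hh : IntegrableOn (fun y => Real.exp (-κ * y) • h y) (Ioi 0))
    (hh' : IntegrableOn (fun y => Real.exp (-κ * y) • h' y) (Ioi 0)) (c : ℝ) (η : ℂ) (σ : ℝ)
    {x : ℝ} (hx : 0 ≤ x) :
    greenFun c κ η σ h x - greenFun c κ η σ h' x = greenFun c κ η σ (fun y => h y - h' y) x := by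
  have hd := (integrableOn_spinorPair_decaySpinor hh η).mono_set (Ioi_subset_Ioi hx)
  have hd' := (integrableOn_spinorPair_decaySpinor hh' η).mono_set (Ioi_subset_Ioi hx)
  have hp := intervalIntegrable_spinorPair_regSpinor hh η σ hx
  have hp' := intervalIntegrable_spinorPair_regSpinor hh' η σ hx
  simp only [greenFun, map_sub, integral_sub hd hd', intervalIntegral.integral_sub hp hp']
  module

end

/-! ### Size of the Green function and the equation it solves -/

namespace GreenData

variable {m c κ σ K : ℝ} {z η : ℂ} {h : ℝ → Spinor}

theorem norm_decaySpinor_mul_norm_regSpinor_le (H : GreenData m c z κ η σ K) {x y : ℝ}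
    (hx : 0 ≤ x) :
    ‖decaySpinor κ η y‖ * ‖regSpinor κ η σ x‖
      ≤ 2 * ‖η‖ * c * K * Real.exp (-κ * (y - x)) := by
  have e : regSpinor κ η σ x = Real.exp (κ * x) •
      (!₂[1 + σ * (Real.exp (-κ * x) ^ 2 : ℝ), η * (1 - σ * (Real.exp (-κ * x) ^ 2 : ℝ))]
        : Spinor) := by
    have e1 : Complex.exp (κ * x) * Complex.exp (-(κ * x)) ^ 2 = Complex.exp (-(κ * x)) := by
      rw [sq, ← mul_assoc, ← Complex.exp_add, add_neg_cancel, Complex.exp_zero, one_mul]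
    ext i
    fin_cases i
    · simp [regSpinor]
      linear_combination (-σ : ℂ) * e1
    · simp [regSpinor]
      linear_combination (σ * η : ℂ) * e1
  have h1 : Real.exp (-κ * x) ≤ 1 := by
    rw [Real.exp_le_one_iff]
    nlinarith [H.κ_pos]
  have h2 := H.norm_mul_norm_le (Real.exp (-κ * x) ^ 2)
    ⟨by positivity, pow_le_one₀ (Real.exp_pos _).le h1⟩
  rw [e, decaySpinor, norm_smul, norm_smul, Real.norm_eq_abs, Real.norm_eq_abs, Real.abs_exp,
    Real.abs_exp]
  have e2 : Real.exp (-κ * (y - x)) = Real.exp (-κ * y) * Real.exp (κ * x) := by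
    rw [← Real.exp_add]
    ring_nf
  rw [e2]
  have := mul_le_mul_of_nonneg_left h2
    (mul_pos (Real.exp_pos (-κ * y)) (Real.exp_pos (κ * x))).le
  linarith

theorem integrableOn_exp_mul_norm (H : GreenData m c z κ η σ K)
    (hh : IntegrableOn (fun y => Real.exp (-κ * y) • h y) (Ioi 0)) (x : ℝ) :
    IntegrableOn (fun y => Real.exp (-κ * |x - y|) * ‖h y‖) (Ioi 0) := by
  have hm : AEStronglyMeasurable h (volume.restrict (Ioi 0)) := by
    have := (Continuous.aestronglyMeasurable (f := fun y : ℝ => Real.exp (κ * y))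
      (by fun_prop)).smul hh.aestronglyMeasurable
    refine this.congr (.of_forall fun y => ?_)
    simp [smul_smul, ← Real.exp_add]
  refine Integrable.mono' (hh.norm.const_mul (Real.exp (κ * |x|)))
    ((Continuous.aestronglyMeasurable (by fun_prop)).mul hm.norm) ?_
  refine .of_forall fun y => ?_
  rw [norm_mul, norm_norm, norm_smul, ← mul_assoc]
  gcongr
  rw [Real.norm_eq_abs, Real.norm_eq_abs, Real.abs_exp, Real.abs_exp, ← Real.exp_add,
    Real.exp_le_exp]
  -- This gives `exp (-κ |x - y|) ≤ exp (κ |x|) exp (-κ y)`, with an integrable majorant.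
  have h1 : y ≤ |x| + |x - y| := by
    have := abs_sub_abs_le_abs_sub y x
    rw [abs_sub_comm y x] at this
    linarith [le_abs_self y]
  nlinarith [H.κ_pos]

/-- The pointwise bound of the Green function. -/
theorem norm_greenFun_le (H : GreenData m c z κ η σ K)
    (hh : IntegrableOn (fun y => Real.exp (-κ * y) • h y) (Ioi 0)) {x : ℝ} (hx : 0 ≤ x) :
    ‖greenFun c κ η σ h x‖ ≤ K * ∫ y in Ioi 0, Real.exp (-κ * |x - y|) * ‖h y‖ := by
  have hint := H.integrableOn_exp_mul_norm hh x
  have hη : 0 < ‖η‖ := norm_pos_iff.2 H.η_ne_zero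
  have hc := H.c_pos
  set A := 2 * ‖η‖ * c with hA
  have hA0 : 0 < A := by positivity
  have b1 : ‖(∫ y in Ioi x, spinorPair (decaySpinor κ η y) (h y)) • regSpinor κ η σ x‖
      ≤ A * K * ∫ y in Ioi x, Real.exp (-κ * |x - y|) * ‖h y‖ := by
    rw [norm_smul, ← integral_const_mul]
    refine (mul_le_mul_of_nonneg_right (norm_integral_le_integral_norm _) (norm_nonneg _)).trans ?_
    rw [← integral_mul_const]
    refine setIntegral_mono_on (((integrableOn_spinorPair_decaySpinor hh η).mono_set
      (Ioi_subset_Ioi hx)).norm.mul_const _) ((hint.mono_set (Ioi_subset_Ioi hx)).const_mul _)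
      measurableSet_Ioi fun y hy => ?_
    have hxy : |x - y| = y - x := by rw [abs_sub_comm, abs_of_nonneg (sub_nonneg.2 (le_of_lt hy))]
    have e := H.norm_decaySpinor_mul_norm_regSpinor_le (y := y) hx
    have := norm_spinorPair_le (decaySpinor κ η y) (h y)
    rw [hxy]
    calc _ ≤ (‖decaySpinor κ η y‖ * ‖h y‖) * ‖regSpinor κ η σ x‖ := by gcongr
      _ = (‖decaySpinor κ η y‖ * ‖regSpinor κ η σ x‖) * ‖h y‖ := by ring
      _ ≤ (A * K * Real.exp (-κ * (y - x))) * ‖h y‖ := by gcongr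
      _ = _ := by ring
  have b2 : ‖(∫ y in (0 : ℝ)..x, spinorPair (regSpinor κ η σ y) (h y)) • decaySpinor κ η x‖
      ≤ A * K * ∫ y in Ioc 0 x, Real.exp (-κ * |x - y|) * ‖h y‖ := by
    rw [norm_smul, ← integral_const_mul, intervalIntegral.integral_of_le hx]
    refine (mul_le_mul_of_nonneg_right (norm_integral_le_integral_norm _) (norm_nonneg _)).trans ?_
    rw [← integral_mul_const]
    have hp := (intervalIntegrable_iff_integrableOn_Ioc_of_le hx).1
      (intervalIntegrable_spinorPair_regSpinor hh η σ hx)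
    refine setIntegral_mono_on (hp.norm.mul_const _)
      ((hint.mono_set Ioc_subset_Ioi_self).const_mul _) measurableSet_Ioc fun y hy => ?_
    have hxy : |x - y| = x - y := abs_of_nonneg (sub_nonneg.2 hy.2)
    have e := H.norm_decaySpinor_mul_norm_regSpinor_le (y := x) hy.1.le
    have := norm_spinorPair_le (regSpinor κ η σ y) (h y)
    rw [hxy]
    calc _ ≤ (‖regSpinor κ η σ y‖ * ‖h y‖) * ‖decaySpinor κ η x‖ := by gcongr
      _ = (‖decaySpinor κ η x‖ * ‖regSpinor κ η σ y‖) * ‖h y‖ := by ring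
      _ ≤ (A * K * Real.exp (-κ * (x - y))) * ‖h y‖ := by gcongr
      _ = _ := by ring
  rw [← Ioc_union_Ioi_eq_Ioi hx, setIntegral_union Ioc_disjoint_Ioi_same measurableSet_Ioi
    (hint.mono_set Ioc_subset_Ioi_self) (hint.mono_set (Ioi_subset_Ioi hx)), greenFun, norm_smul]
  have hn : ‖(2 * η * c)⁻¹‖ = A⁻¹ := by
    rw [norm_inv, norm_mul, norm_mul, Complex.norm_real, Real.norm_eq_abs, abs_of_pos hc]
    simp [hA]
  rw [hn]
  calc _ ≤ A⁻¹ * (A * K * (∫ y in Ioi x, Real.exp (-κ * |x - y|) * ‖h y‖)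
        + A * K * ∫ y in Ioc 0 x, Real.exp (-κ * |x - y|) * ‖h y‖) := by
        gcongr
        exact (norm_add_le _ _).trans (add_le_add b1 b2)
    _ = _ := by
        field_simp
        ring

/-- `greenFun` solves the free Dirac equation. -/
theorem diracExpr_greenFun (H : GreenData m c z κ η σ K) (h : ℝ → Spinor)
    (V : ℝ → Matrix (Fin 2) (Fin 2) ℂ) (x : ℝ) :
    diracExpr m c V (greenFun c κ η σ h) (greenDeriv c κ η σ h) x
      = h x + z • greenFun c κ η σ h x + matAct (V x) (greenFun c κ η σ h x) := by
  rw [diracExpr]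
  congr 1
  have e1 : Complex.exp (κ * x) * Complex.exp (-(κ * x)) = 1 := by
    rw [← Complex.exp_add, add_neg_cancel, Complex.exp_zero]
  have hη := H.η_ne_zero
  have hc : (c : ℂ) ≠ 0 := by exact_mod_cast H.c_pos.ne'
  have h1 := H.mul_add
  have h2 := H.mul_sub
  push_cast at h1 h2
  simp only [greenFun, greenDeriv]
  generalize (∫ y in Ioi x, spinorPair (decaySpinor κ η y) (h y)) = α
  generalize (∫ y in (0 : ℝ)..x, spinorPair (regSpinor κ η σ y) (h y)) = β
  ext i
  fin_cases i
  · simp [spinorPair_apply, decaySpinor,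
      regSpinor]
    generalize Complex.exp (κ * x) = E at *
    generalize Complex.exp (-(κ * x)) = F at *
    field_simp
    -- The homogeneous terms cancel by the free equation; the terms from differentiating the
    -- integrals give `h x` through the Wronskian.
    linear_combination (-(α * (E + F * σ) + F * β)) * h2 + 2 * c * η * h x 0 * e1
  · simp [spinorPair_apply, decaySpinor,
      regSpinor]
    generalize Complex.exp (κ * x) = E at *
    generalize Complex.exp (-(κ * x)) = F at *
    field_simp
    linear_combination (α * (E - F * σ) - F * β) * h1 + 2 * c * η * h x 1 * e1

/-- At `0` the integral over `[0, x]` vanishes, leaving a multiple of `regSpinor` at `0`, namely of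
`(1 + σ, η (1 - σ))`. -/
theorem greenFun_zero_boundary {α : ℝ}
    (hbc : (1 + σ) * Real.cos α - (1 - σ) * Real.sin α * η = 0) :
    greenFun c κ η σ h 0 0 * (Real.cos α : ℂ) - greenFun c κ η σ h 0 1 * (Real.sin α : ℂ) = 0 := by
  simp [greenFun, regSpinor]
  generalize (∫ y in Ioi (0 : ℝ), spinorPair (decaySpinor κ η y) (h y)) = A
  push_cast at hbc
  linear_combination (c : ℂ)⁻¹ * (η⁻¹ * 2⁻¹) * A * hbc

end GreenData

/-! ### Solving the perturbed equation -/

theorem norm_matAct_le (A : Matrix (Fin 2) (Fin 2) ℂ) (s : Spinor) :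
    ‖matAct A s‖ ≤ ‖A‖ * ‖s‖ :=
  (matAct A).le_opNorm s

theorem continuous_matAct :
    Continuous (fun A : Matrix (Fin 2) (Fin 2) ℂ => (matAct A : Spinor →L[ℂ] Spinor)) :=
  (AddMonoidHomClass.isometry_of_norm
    (Matrix.toEuclideanCLM (n := Fin 2) (𝕜 := ℂ)) fun _ => rfl).continuous

theorem MeasureTheory.AEStronglyMeasurable.matAct {α : Type*} [MeasurableSpace α] {μ : Measure α}
    {V : α → Matrix (Fin 2) (Fin 2) ℂ} {u : α → Spinor} (hV : AEStronglyMeasurable V μ)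
    (hu : AEStronglyMeasurable u μ) : AEStronglyMeasurable (fun y => matAct (V y) (u y)) μ :=
  isBoundedBilinearMap_apply.continuous.comp_aestronglyMeasurable
    ((continuous_matAct.comp_aestronglyMeasurable hV).prodMk hu)

theorem integrable_matAct_of_bounded {α : Type*} [MeasurableSpace α] {μ : Measure α}
    {V : α → Matrix (Fin 2) (Fin 2) ℂ} {u : α → Spinor} (hV : Integrable V μ)
    (hu : AEStronglyMeasurable u μ) {C : ℝ} (hC : ∀ y, ‖u y‖ ≤ C) :
    Integrable (fun y => matAct (V y) (u y)) μ := by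
  refine (hV.norm.mul_const C).mono' (hV.aestronglyMeasurable.matAct hu) (.of_forall fun y => ?_)
  exact (norm_matAct_le _ _).trans (mul_le_mul_of_nonneg_left (hC y) (norm_nonneg _))

theorem integrableOn_exp_smul_of_integrableOn {κ : ℝ} (hκ : 0 < κ) {g : ℝ → Spinor}
    (hg : IntegrableOn g (Ioi 0)) : IntegrableOn (fun y => Real.exp (-κ * y) • g y) (Ioi 0) := by
  refine Integrable.mono' hg.norm
    ((Continuous.aestronglyMeasurable (f := fun y : ℝ => Real.exp (-κ * y))
      (by fun_prop)).smul hg.aestronglyMeasurable) ?_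
  filter_upwards [ae_restrict_mem measurableSet_Ioi] with y hy
  rw [norm_smul, Real.norm_eq_abs, Real.abs_exp]
  refine mul_le_of_le_one_left (norm_nonneg _) ?_
  rw [Real.exp_le_one_iff]
  nlinarith [mem_Ioi.1 hy]

/-- The inequality `p r ≤ p² + r²` replaces Hölder's when the exponential kernel meets an `L²`
function. -/
theorem exp_mul_le_exp_add_sq (κ x y r : ℝ) :
    Real.exp (-κ * |x - y|) * r ≤ Real.exp (-(2 * κ) * |x - y|) + r ^ 2 := by
  have e : Real.exp (-(2 * κ) * |x - y|) = Real.exp (-κ * |x - y|) ^ 2 := by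
    rw [sq, ← Real.exp_add]
    ring_nf
  rw [e]
  nlinarith [sq_nonneg (Real.exp (-κ * |x - y|) - r), sq_nonneg (Real.exp (-κ * |x - y|)),
    sq_nonneg r]

theorem integrableOn_exp_smul_of_memLp {κ : ℝ} (hκ : 0 < κ) {f : ℝ → Spinor}
    (hf : MemLp f 2 (volume.restrict (Ioi 0))) :
    IntegrableOn (fun y => Real.exp (-κ * y) • f y) (Ioi 0) := by
  refine Integrable.mono' ((integrable_exp_neg_mul_abs_sub (κ := 2 * κ) (by linarith)
    0).integrableOn.add (hf.integrable_norm_pow (by norm_num)))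
    ((Continuous.aestronglyMeasurable (f := fun y : ℝ => Real.exp (-κ * y))
      (by fun_prop)).smul hf.aestronglyMeasurable) ?_
  filter_upwards [ae_restrict_mem measurableSet_Ioi] with y hy
  have := exp_mul_le_exp_add_sq κ 0 y ‖f y‖
  rw [norm_smul, Real.norm_eq_abs, Real.abs_exp]
  rw [zero_sub, abs_neg, abs_of_pos (mem_Ioi.1 hy)] at this
  simpa [abs_of_pos (mem_Ioi.1 hy)] using this

/-! ### Mapping properties of the Green function and the fixed-point equation -/

namespace GreenData

variable {m c κ σ K : ℝ} {z η : ℂ} {h : ℝ → Spinor}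

/-- Boundedness of `G f` is what allows the fixed point to be sought among bounded functions
although `f` is only in `L²`. -/
theorem exists_bound_of_memLp (H : GreenData m c z κ η σ K) {f : ℝ → Spinor}
    (hf : MemLp f 2 (volume.restrict (Ioi 0))) :
    ∃ C, ∀ x, 0 ≤ x → ‖greenFun c κ η σ f x‖ ≤ C := by
  have hadm := integrableOn_exp_smul_of_memLp H.κ_pos hf
  have hκ := H.κ_pos
  have hsq : IntegrableOn (fun y => ‖f y‖ ^ 2) (Ioi 0) := hf.integrable_norm_pow (by norm_num)
  refine ⟨K * (2 / (2 * κ) + ∫ y in Ioi 0, ‖f y‖ ^ 2), fun x hx => ?_⟩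
  refine (H.norm_greenFun_le hadm hx).trans ?_
  refine mul_le_mul_of_nonneg_left ?_ H.K_nonneg
  have hexp := integrable_exp_neg_mul_abs_sub (κ := 2 * κ) (by linarith) x
  calc _ ≤ ∫ y in Ioi 0, (Real.exp (-(2 * κ) * |x - y|) + ‖f y‖ ^ 2) :=
        integral_mono (H.integrableOn_exp_mul_norm hadm x) (Integrable.add hexp.integrableOn hsq)
          fun y => exp_mul_le_exp_add_sq κ x y _
    _ = (∫ y in Ioi 0, Real.exp (-(2 * κ) * |x - y|)) + ∫ y in Ioi 0, ‖f y‖ ^ 2 :=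
        integral_add hexp.integrableOn hsq
    _ ≤ _ := by
        gcongr
        rw [← integral_exp_neg_mul_abs_sub (κ := 2 * κ) (by linarith) x]
        exact setIntegral_le_integral hexp (.of_forall fun y => (Real.exp_pos _).le)

theorem memLp_greenFun (H : GreenData m c z κ η σ K)
    (hh : IntegrableOn (fun y => Real.exp (-κ * y) • h y) (Ioi 0))
    (hfin : ∫⁻ x in Ioi 0, (∫⁻ y in Ioi 0, expKernel κ x y * ‖h y‖ₑ) ^ 2 < ⊤) :
    MemLp (greenFun c κ η σ h) 2 (volume.restrict (Ioi 0)) := by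
  refine ⟨((isLocPrimitive_greenFun hh c η σ).continuousOn.mono
    Ioi_subset_Ici_self).aestronglyMeasurable measurableSet_Ioi, ?_⟩
  rw [eLpNorm_lt_top_iff_lintegral_rpow_enorm_lt_top (by norm_num) (by norm_num)]
  have hb : ∀ x ∈ Ioi (0 : ℝ), ‖greenFun c κ η σ h x‖ₑ ^ (2 : ENNReal).toReal
      ≤ ENNReal.ofReal K ^ 2 * (∫⁻ y in Ioi 0, expKernel κ x y * ‖h y‖ₑ) ^ 2 := by
    intro x hx
    have h1 := H.norm_greenFun_le hh (le_of_lt (mem_Ioi.1 hx))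
    rw [← mul_pow, ENNReal.toReal_ofNat, ENNReal.rpow_ofNat]
    gcongr
    rw [← ofReal_norm]
    refine (ENNReal.ofReal_le_ofReal h1).trans ?_
    rw [ENNReal.ofReal_mul H.K_nonneg, ofReal_integral_eq_lintegral_ofReal
      (H.integrableOn_exp_mul_norm hh x) (.of_forall fun y => by positivity)]
    gcongr with y
    rw [ENNReal.ofReal_mul (Real.exp_pos _).le, ofReal_norm, expKernel]
  refine (setLIntegral_mono' measurableSet_Ioi hb).trans_lt ?_
  rw [lintegral_const_mul' _ _ (ENNReal.pow_ne_top ENNReal.ofReal_ne_top)]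
  exact ENNReal.mul_lt_top (ENNReal.pow_lt_top ENNReal.ofReal_lt_top) hfin

theorem memLp_greenFun_of_memLp (H : GreenData m c z κ η σ K)
    (hf : MemLp h 2 (volume.restrict (Ioi 0))) :
    MemLp (greenFun c κ η σ h) 2 (volume.restrict (Ioi 0)) := by
  refine H.memLp_greenFun (integrableOn_exp_smul_of_memLp H.κ_pos hf) ?_
  refine (lintegral_sq_lintegral_expKernel_mul_le H.κ_pos hf.aestronglyMeasurable.enorm).trans_lt ?_
  have := (eLpNorm_lt_top_iff_lintegral_rpow_enorm_lt_top (by norm_num) (by norm_num)).1 hf.2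
  simp only [ENNReal.toReal_ofNat, ENNReal.rpow_ofNat] at this
  exact ENNReal.mul_lt_top (ENNReal.pow_lt_top ENNReal.ofReal_lt_top) this

theorem memLp_greenFun_of_integrableOn (H : GreenData m c z κ η σ K)
    (hg : IntegrableOn h (Ioi 0)) :
    MemLp (greenFun c κ η σ h) 2 (volume.restrict (Ioi 0)) := by
  refine H.memLp_greenFun (integrableOn_exp_smul_of_integrableOn H.κ_pos hg) ?_
  refine (lintegral_sq_lintegral_expKernel_mul_le' H.κ_pos hg.aestronglyMeasurable.enorm
    hg.2.ne).trans_lt ?_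
  exact ENNReal.mul_lt_top ENNReal.ofReal_lt_top (ENNReal.pow_lt_top hg.2)

/-- Banach's theorem in the sup norm: `u ↦ G (V u)` has norm at most `q`, while `G f` is a fixed
bounded function. -/
theorem exists_fixedPoint (H : GreenData m c z κ η σ K)
    {V : ℝ → Matrix (Fin 2) (Fin 2) ℂ} (hV : IntegrableOn V (Ioi 0)) {q : ℝ} (hq : q < 1)
    (hqV : ∀ x, 0 ≤ x → K * ∫ y in Ioi 0, Real.exp (-κ * |x - y|) * ‖V y‖ ≤ q)
    {f : ℝ → Spinor} (hf : MemLp f 2 (volume.restrict (Ioi 0))) :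
    ∃ u : BoundedContinuousFunction ℝ Spinor, ∀ x, 0 ≤ x →
      u x = greenFun c κ η σ (fun y => f y - matAct (V y) (u y)) x := by
  have hκ := H.κ_pos
  have hf' := integrableOn_exp_smul_of_memLp hκ hf
  have hVu : ∀ u : BoundedContinuousFunction ℝ Spinor,
      IntegrableOn (fun y => matAct (V y) (u y)) (Ioi 0) := fun u =>
    integrable_matAct_of_bounded hV u.continuous.aestronglyMeasurable u.norm_coe_le_norm
  have hVu' := fun u => integrableOn_exp_smul_of_integrableOn hκ (hVu u)
  have hadm : ∀ u : BoundedContinuousFunction ℝ Spinor,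
      IntegrableOn (fun y => Real.exp (-κ * y) • (f y - matAct (V y) (u y))) (Ioi 0) := fun u => by
    exact (Integrable.sub hf' (hVu' u)).congr (.of_forall fun y => (smul_sub _ _ _).symm)
  have hpert : ∀ u : BoundedContinuousFunction ℝ Spinor, ∀ x, 0 ≤ x →
      ‖greenFun c κ η σ (fun y => matAct (V y) (u y)) x‖ ≤ q * ‖u‖ := by
    intro u x hx
    refine (H.norm_greenFun_le (hVu' u) hx).trans ?_
    refine le_trans ?_ (mul_le_mul_of_nonneg_right (hqV x hx) (norm_nonneg u))
    rw [mul_assoc, ← integral_mul_const]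
    refine mul_le_mul_of_nonneg_left ?_ H.K_nonneg
    refine integral_mono (H.integrableOn_exp_mul_norm (hVu' u) x)
      ((integrableOn_exp_mul_of_integrableOn hκ hV.norm x).mul_const _) fun y => ?_
    simp only [mul_assoc]
    gcongr
    exact (norm_matAct_le _ _).trans
      (mul_le_mul_of_nonneg_left (u.norm_coe_le_norm y) (norm_nonneg _))
  obtain ⟨C, hC⟩ := H.exists_bound_of_memLp hf
  let Φ : BoundedContinuousFunction ℝ Spinor → BoundedContinuousFunction ℝ Spinor := fun u =>
    BoundedContinuousFunction.ofNormedAddCommGroup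
      -- The cutoff `max x 0` extends the function continuously by a constant to the negative axis.
      (fun x => greenFun c κ η σ (fun y => f y - matAct (V y) (u y)) (max x 0))
      ((isLocPrimitive_greenFun (hadm u) c η σ).continuousOn.comp_continuous
        (continuous_id.max continuous_const) fun x => mem_Ici.2 (le_max_right _ _))
      (C + q * ‖u‖) fun x => by
        rw [← greenFun_sub hf' (hVu' u) c η σ (le_max_right x 0)]
        exact (norm_sub_le _ _).trans
          (add_le_add (hC _ (le_max_right _ _)) (hpert u _ (le_max_right _ _)))
  have hq0 : 0 ≤ q := (mul_nonneg H.K_nonneg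
    (integral_nonneg fun y => by positivity)).trans (hqV 0 le_rfl)
  have hΦ : ContractingWith ⟨q, hq0⟩ Φ := by
    refine ⟨by exact_mod_cast hq, LipschitzWith.of_dist_le_mul fun u u' => ?_⟩
    refine (BoundedContinuousFunction.dist_le (mul_nonneg hq0 dist_nonneg)).2 fun x => ?_
    have e := greenFun_sub (hadm u) (hadm u') c η σ (le_max_right x 0)
    have e' : (fun y => (f y - matAct (V y) (u y)) - (f y - matAct (V y) (u' y)))
        = fun y => matAct (V y) ((u' - u) y) := by
      funext y
      rw [BoundedContinuousFunction.sub_apply, map_sub]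
      abel
    rw [e'] at e
    rw [dist_eq_norm, dist_comm, dist_eq_norm]
    refine (le_of_eq (congrArg norm e)).trans (hpert (u' - u) _ (le_max_right _ _))
  refine ⟨hΦ.fixedPoint, fun x hx => ?_⟩
  have := congrArg (fun g : BoundedContinuousFunction ℝ Spinor => g x) hΦ.fixedPoint_isFixedPt
  simp only [Φ, BoundedContinuousFunction.coe_ofNormedAddCommGroup, max_eq_left hx] at this
  exact this.symm

/-- If the potential is small with respect to the free Green function at `z`, then
`D₀ + V - z` is surjective. -/
theorem exists_mem_diracGraph (H : GreenData m c z κ η σ K) {α : ℝ}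
    (hbc : (1 + σ) * Real.cos α - (1 - σ) * Real.sin α * η = 0)
    {V : ℝ → Matrix (Fin 2) (Fin 2) ℂ} (hV : IntegrableOn V (Ioi 0)) {q : ℝ} (hq : q < 1)
    (hqV : ∀ x, 0 ≤ x → K * ∫ y in Ioi 0, Real.exp (-κ * |x - y|) * ‖V y‖ ≤ q)
    (f : HalfLineL2) : ∃ ψ : HalfLineL2, (ψ, f + z • ψ) ∈ diracGraph m c α V := by
  have hf := Lp.memLp f
  obtain ⟨u, hu⟩ := H.exists_fixedPoint hV hq hqV hf
  have hf' := integrableOn_exp_smul_of_memLp H.κ_pos hf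
  have hVu : IntegrableOn (fun y => matAct (V y) (u y)) (Ioi 0) :=
    integrable_matAct_of_bounded hV u.continuous.aestronglyMeasurable u.norm_coe_le_norm
  have hVu' := integrableOn_exp_smul_of_integrableOn H.κ_pos hVu
  have hadm : IntegrableOn (fun y => Real.exp (-κ * y) • (f y - matAct (V y) (u y))) (Ioi 0) := by
    exact (Integrable.sub hf' hVu').congr (.of_forall fun y => (smul_sub _ _ _).symm)
  set h : ℝ → Spinor := fun y => f y - matAct (V y) (u y) with hh
  -- The two parts of `h` reach `L²` differently: `f` by Schur's test, and `V u` because it is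
  -- integrable.
  have hmem : MemLp (greenFun c κ η σ h) 2 (volume.restrict (Ioi 0)) := by
    refine ((H.memLp_greenFun_of_memLp hf).sub (H.memLp_greenFun_of_integrableOn hVu)).ae_eq ?_
    filter_upwards [ae_restrict_mem measurableSet_Ioi] with x hx
    exact greenFun_sub hf' hVu' c η σ (le_of_lt hx)
  refine ⟨hmem.toLp _, greenFun c κ η σ h, greenDeriv c κ η σ h,
    (isLocPrimitive_greenFun hadm c η σ).isLocACWithDeriv, hmem.coeFn_toLp,
    greenFun_zero_boundary hbc, ?_⟩
  filter_upwards [ae_restrict_mem measurableSet_Ioi, Lp.coeFn_add f (z • hmem.toLp _),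
    Lp.coeFn_smul z (hmem.toLp _), hmem.coeFn_toLp] with x hx h1 h2 h3
  rw [H.diracExpr_greenFun, ← hu x (le_of_lt hx)]
  change (f + z • hmem.toLp _ : HalfLineL2) x = _
  rw [h1, Pi.add_apply, h2, Pi.smul_apply, h3, ← hu x (le_of_lt hx), hh]
  simp only
  abel

end GreenData

/-! ### Resolvents of symmetric operators -/

section SymmetricOperators

variable {H : Type*} [NormedAddCommGroup H] [InnerProductSpace ℂ H]

/-- Symmetry of an unbounded operator. -/
def LinearPMap.Symmetric (A : H →ₗ.[ℂ] H) : Prop :=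
  ∀ ψ φ : A.domain, inner ℂ (A ψ) (φ : H) = inner ℂ (ψ : H) (A φ)

/-- Surjectivity of `A - z`. -/
def LinearPMap.SubSurjective (A : H →ₗ.[ℂ] H) (z : ℂ) : Prop :=
  ∀ f : H, ∃ ψ : A.domain, A ψ - z • (ψ : H) = f

namespace LinearPMap.Symmetric

variable {A : H →ₗ.[ℂ] H} {z : ℂ}

theorem inner_sub_smul (hA : A.Symmetric) (z : ℂ) (ψ φ : A.domain) :
    inner ℂ (A ψ - z • (ψ : H)) (φ : H) = inner ℂ (ψ : H) (A φ - starRingEnd ℂ z • (φ : H)) := by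
  rw [inner_sub_left, inner_sub_right, hA, inner_smul_left, inner_smul_right]

/-- `|Im z| ‖ψ‖ ≤ ‖(A - z) ψ‖`. -/
theorem abs_im_mul_norm_le (hA : A.Symmetric) (z : ℂ) (ψ : A.domain) :
    |z.im| * ‖(ψ : H)‖ ≤ ‖A ψ - z • (ψ : H)‖ := by
  rcases eq_or_ne ‖(ψ : H)‖ 0 with h0 | h0
  · rw [h0, mul_zero]
    exact norm_nonneg _
  have hpos : 0 < ‖(ψ : H)‖ := lt_of_le_of_ne (norm_nonneg _) (Ne.symm h0)
  have him : (inner ℂ (ψ : H) (A ψ)).im = 0 := by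
    have h1 := inner_conj_symm (𝕜 := ℂ) (ψ : H) (A ψ)
    rw [hA ψ ψ] at h1
    exact Complex.conj_eq_iff_im.1 h1
  have h2 : (inner ℂ (ψ : H) (A ψ - z • (ψ : H))).im = -z.im * ‖(ψ : H)‖ ^ 2 := by
    rw [inner_sub_right, inner_smul_right, Complex.sub_im, him, inner_self_eq_norm_sq_to_K]
    simp [← Complex.ofReal_pow]
  have h3 : |(inner ℂ (ψ : H) (A ψ - z • (ψ : H))).im| ≤ ‖(ψ : H)‖ * ‖A ψ - z • (ψ : H)‖ :=
    (Complex.abs_im_le_norm _).trans (norm_inner_le_norm _ _)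
  rw [h2, abs_mul, abs_neg, abs_of_nonneg (sq_nonneg ‖(ψ : H)‖)] at h3
  refine le_of_mul_le_mul_left ?_ hpos
  linarith

/-- `A - z` is injective if `z` is not real or if `A - z` is surjective. -/
theorem sub_injective (hA : A.Symmetric) (hz : z.im ≠ 0 ∨ A.SubSurjective z) {ψ φ : A.domain}
    (h : A ψ - z • (ψ : H) = A φ - z • (φ : H)) : ψ = φ := by
  have hd : A (ψ - φ) - z • ((ψ - φ : A.domain) : H) = 0 := by
    rw [LinearPMap.map_sub, Submodule.coe_sub, smul_sub, sub_sub_sub_comm, h, sub_self]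
  by_cases him : z.im = 0
  · have hs := hz.resolve_left (not_not.2 him)
    -- For real `z` the kernel of `A - z` is orthogonal to its range, so a kernel vector in the
    -- range is orthogonal to itself.
    obtain ⟨χ, hχ⟩ := hs ((ψ - φ : A.domain) : H)
    have h1 := hA.inner_sub_smul z (ψ - φ) χ
    rw [hd, Complex.conj_eq_iff_im.2 him, hχ, inner_zero_left] at h1
    have := inner_self_eq_zero.1 h1.symm
    exact sub_eq_zero.1 (Subtype.ext this)
  · have h1 := hA.abs_im_mul_norm_le z (ψ - φ)
    rw [hd, norm_zero] at h1
    have h2 : ‖((ψ - φ : A.domain) : H)‖ = 0 := by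
      have := abs_pos.2 him
      nlinarith [norm_nonneg ((ψ - φ : A.domain) : H)]
    exact sub_eq_zero.1 (Subtype.ext (norm_eq_zero.1 h2))

/-- A symmetric operator `A` with `A - z` surjective has `z` in its resolvent set. -/
theorem mem_opResolventSet [CompleteSpace H] (hA : A.Symmetric) (hs : A.SubSurjective z) :
    z ∈ opResolventSet A := by
  let L : A.domain →ₗ[ℂ] H := A.toFun - z • A.domain.subtype
  have hL : ∀ ψ, L ψ = A ψ - z • (ψ : H) := fun ψ => rfl
  let e : A.domain ≃ₗ[ℂ] H := LinearEquiv.ofBijective L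
    ⟨fun ψ φ h => hA.sub_injective (.inr hs) (by simpa only [hL] using h), fun f => hs f⟩
  have he : ∀ f, A (e.symm f) - z • ((e.symm f : A.domain) : H) = f := fun f =>
    e.apply_symm_apply f
  let T : H →ₗ[ℂ] H := A.domain.subtype ∘ₗ e.symm.toLinearMap
  have hT : ∀ f, T f = ((e.symm f : A.domain) : H) := fun f => rfl
  have hcont : ∃ R : H →L[ℂ] H, ∀ f, R f = T f := by
    by_cases him : z.im = 0
    -- For real `z` the inverse is symmetric and everywhere defined, hence bounded by the
    -- Hellinger-Toeplitz theorem.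
    · have hsym : T.IsSymmetric := fun f g => by
        have := hA.inner_sub_smul z (e.symm f) (e.symm g)
        rw [Complex.conj_eq_iff_im.2 him, he, he] at this
        rw [hT, hT, ← this]
      exact ⟨⟨T, hsym.continuous⟩, fun f => rfl⟩
    · refine ⟨T.mkContinuous |z.im|⁻¹ fun f => ?_, fun f => rfl⟩
      have := hA.abs_im_mul_norm_le z (e.symm f)
      rw [he] at this
      rwa [hT, ← div_eq_inv_mul, le_div_iff₀' (abs_pos.2 him)]
  obtain ⟨R, hR⟩ := hcont
  refine ⟨R, fun f => ?_, fun ψ => ?_⟩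
  · have h0 : R f = ((e.symm f : A.domain) : H) := hR f
    have h1 : R f ∈ A.domain := h0 ▸ (e.symm f).2
    refine ⟨h1, ?_⟩
    have h2 : (⟨R f, h1⟩ : A.domain) = e.symm f := Subtype.ext h0
    rw [h2, h0, he]
  · rw [hR, hT]
    exact congrArg Subtype.val (e.symm_apply_apply ψ)

/-- Surjectivity at `w` implies surjectivity in the disc of radius `|Im w|`. -/
theorem subSurjective_of_norm_sub_lt [CompleteSpace H] (hA : A.Symmetric) {w : ℂ}
    (hw : A.SubSurjective w) (hzw : ‖z - w‖ < |w.im|) : A.SubSurjective z := by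
  obtain ⟨R, hR, -⟩ := hA.mem_opResolventSet hw
  have him : 0 < |w.im| := (norm_nonneg _).trans_lt hzw
  have hn : ‖R‖ ≤ |w.im|⁻¹ := by
    refine R.opNorm_le_bound (inv_nonneg.2 (abs_nonneg _)) fun f => ?_
    obtain ⟨h, hf⟩ := hR f
    have := hA.abs_im_mul_norm_le w ⟨R f, h⟩
    rw [hf] at this
    rwa [← div_eq_inv_mul, le_div_iff₀' him]
  have hlt : ‖(z - w) • R‖ < 1 := by
    rw [norm_smul]
    calc ‖z - w‖ * ‖R‖ ≤ ‖z - w‖ * |w.im|⁻¹ := by gcongr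
      _ < 1 := by rwa [← div_eq_mul_inv, div_lt_one him]
  intro f
  -- On the domain `A - z = (1 - (z - w) R) (A - w)`, and the first factor is inverted by a Neumann
  -- series.
  let U := Units.oneSub ((z - w) • R) hlt
  set g := (↑U⁻¹ : H →L[ℂ] H) f with hg
  have hUg : g - (z - w) • R g = f := by
    have : ((↑U : H →L[ℂ] H) * ↑U⁻¹) f = f := by rw [Units.mul_inv]; rfl
    exact this
  obtain ⟨h, hf⟩ := hR g
  refine ⟨⟨R g, h⟩, ?_⟩
  rw [← hUg]
  nth_rewrite 3 [← hf]
  module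

/-- If `A - i t` is surjective for all real `t` of large absolute value, then all nonreal numbers
lie in the resolvent set. -/
theorem mem_opResolventSet_of_im_ne_zero [CompleteSpace H] (hA : A.Symmetric) {t₀ : ℝ}
    (hs : ∀ t : ℝ, t₀ ≤ |t| → A.SubSurjective (t * Complex.I)) (hz : z.im ≠ 0) :
    z ∈ opResolventSet A := by
  refine hA.mem_opResolventSet ?_
  -- The last condition says `|z - i t| < |t|` when `|t| = s` and `t` has the sign of `Im z`: the
  -- disc about `i t` touching the real axis then contains `z`.
  obtain ⟨s, hs0, hs1, hs2⟩ : ∃ s : ℝ, t₀ ≤ s ∧ 0 < s ∧ Complex.normSq z < 2 * s * |z.im| := by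
    have him := abs_pos.2 hz
    refine ⟨max t₀ ((Complex.normSq z + 1) / (2 * |z.im|)), le_max_left _ _, ?_, ?_⟩
    · have := Complex.normSq_nonneg z
      exact lt_max_of_lt_right (by positivity)
    · have h := le_max_right t₀ ((Complex.normSq z + 1) / (2 * |z.im|))
      rw [div_le_iff₀ (by positivity)] at h
      linarith
  obtain ⟨t, ht1, ht2⟩ : ∃ t : ℝ, |t| = s ∧ t * z.im = s * |z.im| := by
    rcases lt_or_gt_of_ne hz with h | h
    · exact ⟨-s, by rw [abs_neg, abs_of_pos hs1], by rw [abs_of_neg h]; ring⟩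
    · exact ⟨s, abs_of_pos hs1, by rw [abs_of_pos h]⟩
  refine hA.subSurjective_of_norm_sub_lt (hs t (ht1 ▸ hs0)) ?_
  have him : ((t : ℂ) * Complex.I).im = t := by simp
  rw [him, ← abs_of_nonneg (norm_nonneg (z - t * Complex.I)), ← sq_lt_sq,
    ← Complex.normSq_eq_norm_sq]
  rw [Complex.normSq_apply] at hs2 ⊢
  simp
  nlinarith

end LinearPMap.Symmetric

end SymmetricOperators

/-! ### Symmetry of the Dirac operator -/

theorem inner_matAct_left (A : Matrix (Fin 2) (Fin 2) ℂ) (s t : Spinor) :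
    inner ℂ (matAct A s) t = inner ℂ s (matAct A.conjTranspose t) := by
  rw [← ContinuousLinearMap.adjoint_inner_right]
  congr 1
  have := map_star (Matrix.toEuclideanCLM (n := Fin 2) (𝕜 := ℂ)) A
  rw [Matrix.star_eq_conjTranspose] at this
  rw [matAct, matAct, this]
  rfl

/-- The pointwise Lagrange identity. -/
theorem inner_diracExpr_sub (m c : ℝ) {V : ℝ → Matrix (Fin 2) (Fin 2) ℂ} (u w v z : ℝ → Spinor)
    {x : ℝ} (hV : (V x).IsHermitian) :
    inner ℂ (diracExpr m c V u w x) (v x) - inner ℂ (u x) (diracExpr m c V v z x)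
      = inner ℂ (matAct !![0, -(c : ℂ); (c : ℂ), 0] (u x)) (z x)
        + inner ℂ (matAct !![0, -(c : ℂ); (c : ℂ), 0] (w x)) (v x) := by
  have hJ : (!![0, -(c : ℂ); (c : ℂ), 0]).conjTranspose = -!![0, -(c : ℂ); (c : ℂ), 0] := by
    ext i j
    fin_cases i <;> fin_cases j <;> simp
  have hM : (!![((m * c ^ 2 : ℝ) : ℂ), 0; 0, -((m * c ^ 2 : ℝ) : ℂ)]).conjTranspose
      = !![((m * c ^ 2 : ℝ) : ℂ), 0; 0, -((m * c ^ 2 : ℝ) : ℂ)] := by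
    ext i j
    fin_cases i <;> fin_cases j <;> simp [-Complex.ofReal_mul, -Complex.ofReal_pow]
  have hJz : matAct (-!![0, -(c : ℂ); (c : ℂ), 0]) (z x)
      = -matAct !![0, -(c : ℂ); (c : ℂ), 0] (z x) := by
    rw [matAct, map_neg]
    rfl
  simp only [diracExpr, inner_add_left, inner_add_right]
  rw [inner_matAct_left !![((m * c ^ 2 : ℝ) : ℂ), 0; 0, -((m * c ^ 2 : ℝ) : ℂ)], hM,
    inner_matAct_left (V x), hV.eq, inner_matAct_left _ (u x) (z x), hJ, hJz,
    inner_neg_right]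
  ring

/-- Both spinors are multiples of the real vector `(sin α, cos α)`, on which the skew form vanishes.
-/
theorem inner_boundary_eq_zero (c α : ℝ) {s t : Spinor}
    (hs : s 0 * (Real.cos α : ℂ) - s 1 * (Real.sin α : ℂ) = 0)
    (ht : t 0 * (Real.cos α : ℂ) - t 1 * (Real.sin α : ℂ) = 0) :
    inner ℂ (matAct !![0, -(c : ℂ); (c : ℂ), 0] s) t = 0 := by
  have h1 : (Real.cos α : ℂ) ^ 2 + (Real.sin α : ℂ) ^ 2 = 1 := by
    exact_mod_cast Real.cos_sq_add_sin_sq α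
  have hs' := congrArg (starRingEnd ℂ) hs
  simp only [map_sub, map_mul, Complex.conj_ofReal, map_zero] at hs'
  rw [PiLp.inner_apply, Fin.sum_univ_two]
  simp [Matrix.vecHead, Matrix.vecTail]
  generalize starRingEnd ℂ (s.ofLp 0) = a at *
  generalize starRingEnd ℂ (s.ofLp 1) = b at *
  push_cast at *
  generalize Complex.cos α = C at *
  generalize Complex.sin α = S at *
  linear_combination c * (C * t 1 + S * t 0) * hs' - c * (b * C + a * S) * ht
    - c * (t 1 * a - t 0 * b) * h1

/-- By Lagrange's identity the difference of the two sides is the integral of `b'`, where `b = ⟨J u,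
v⟩` vanishes at `0`. As `b'` is integrable, `b` has a limit at infinity; as `b` is integrable, this
limit is `0`. -/
theorem inner_eq_of_mem_diracGraph {m c α : ℝ} {V : ℝ → Matrix (Fin 2) (Fin 2) ℂ}
    (hV : ∀ᵐ x ∂(volume.restrict (Ioi (0 : ℝ))), (V x).IsHermitian)
    {p q : HalfLineL2 × HalfLineL2} (hp : p ∈ diracGraph m c α V) (hq : q ∈ diracGraph m c α V) :
    inner ℂ p.2 q.1 = inner ℂ p.1 q.2 := by
  obtain ⟨u, w, huw, hu, hbu, hφ⟩ := hp
  obtain ⟨v, z, hvz, hv, hbv, hχ⟩ := hq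
  set J : Spinor →L[ℂ] Spinor := matAct !![0, -(c : ℂ); (c : ℂ), 0] with hJ
  set b : ℝ → ℂ := fun x => inner ℂ (J (u x)) (v x) with hb
  set b' : ℝ → ℂ := fun x => inner ℂ (J (u x)) (z x) + inner ℂ (J (w x)) (v x) with hb'
  have hprim : IsLocPrimitive b b' :=
    (huw.isLocPrimitive.clm_apply (J.restrictScalars ℝ)).bilinear
      (isBoundedBilinearMap_inner (𝕜 := ℂ) (E := Spinor)) hvz.isLocPrimitive
  have hb0 : b 0 = 0 := inner_boundary_eq_zero c α hbu hbv
  have hae : (fun x => inner ℂ (p.2 x) (q.1 x) - inner ℂ (p.1 x) (q.2 x))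
      =ᵐ[volume.restrict (Ioi (0 : ℝ))] b' := by
    filter_upwards [hu, hφ, hv, hχ, hV] with x h1 h2 h3 h4 h5
    rw [h1, h2, h3, h4, inner_diracExpr_sub m c u w v z h5]
  have hi1 := L2.integrable_inner (𝕜 := ℂ) p.2 q.1
  have hi2 := L2.integrable_inner (𝕜 := ℂ) p.1 q.2
  have hint' : IntegrableOn b' (Ioi 0) := (hi1.sub hi2).congr hae
  have hint : IntegrableOn b (Ioi 0) := by
    refine (L2.integrable_inner (𝕜 := ℂ) (J.compLp p.1) q.1).congr ?_
    filter_upwards [hu, hv, J.coeFn_compLp p.1] with x h1 h2 h3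
    rw [h3, h1, h2]
  have hlim : Filter.Tendsto b Filter.atTop (nhds (∫ x in Ioi 0, b' x)) := by
    refine (intervalIntegral_tendsto_integral_Ioi 0 hint' Filter.tendsto_id).congr' ?_
    filter_upwards [Filter.eventually_ge_atTop 0] with x hx
    rw [hprim.eq_integral x hx, hb0, zero_add, id]
  have hzero : ∫ x in Ioi 0, b' x = 0 := by
    refine IntegrableAtFilter.eq_zero_of_tendsto (μ := volume)
      ⟨Ioi 0, Filter.Ioi_mem_atTop 0, hint⟩ (fun s hs => ?_) hlim
    obtain ⟨a, ha⟩ := Filter.mem_atTop_sets.1 hs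
    exact top_le_iff.1 (Real.volume_Ici (a := a) ▸ measure_mono ha)
  rw [← sub_eq_zero, L2.inner_def, L2.inner_def, ← integral_sub hi1 hi2, integral_congr_ae hae,
    hzero]

theorem diracOperator_symmetric {m c α : ℝ} {V : ℝ → Matrix (Fin 2) (Fin 2) ℂ}
    (hV : ∀ᵐ x ∂(volume.restrict (Ioi (0 : ℝ))), (V x).IsHermitian) :
    (diracOperator m c α V).Symmetric := fun ψ φ => by
  have h : ∀ χ : (diracOperator m c α V).domain,
      ((χ : HalfLineL2), diracOperator m c α V χ) ∈ diracGraph m c α V := fun χ => by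
    rw [← diracOperator_graph]
    exact LinearPMap.mem_graph _ χ
  exact inner_eq_of_mem_diracGraph hV (h ψ) (h φ)

theorem GreenData.subSurjective {m c κ σ K : ℝ} {z η : ℂ} (H : GreenData m c z κ η σ K) {α : ℝ}
    (hbc : (1 + σ) * Real.cos α - (1 - σ) * Real.sin α * η = 0)
    {V : ℝ → Matrix (Fin 2) (Fin 2) ℂ} (hV : IntegrableOn V (Ioi 0)) {q : ℝ} (hq : q < 1)
    (hqV : ∀ x, 0 ≤ x → K * ∫ y in Ioi 0, Real.exp (-κ * |x - y|) * ‖V y‖ ≤ q) :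
    (diracOperator m c α V).SubSurjective z := fun f => by
  obtain ⟨ψ, hψ⟩ := H.exists_mem_diracGraph hbc hV hq hqV f
  rw [← diracOperator_graph, LinearPMap.mem_graph_iff] at hψ
  obtain ⟨χ, h1, h2⟩ := hψ
  refine ⟨χ, ?_⟩
  rw [h2, h1]
  exact add_sub_cancel_right _ _

/-! ### The spectrum -/

/-- The squared norm of the second spinor is convex in `t`, hence lies below its chord; `h0` and
`h1` are the bounds at `t = 0` and `t = 1`. -/
theorem norm_one_neg_mul_norm_le {η : ℂ} {σ r t B : ℝ} (hr : ‖η‖ = r) (hσ : σ ^ 2 = 1)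
    (ht : t ∈ Icc (0 : ℝ) 1) (hB : 0 ≤ B)
    (h0 : (1 + r ^ 2) ^ 2 ≤ B ^ 2)
    (h1 : (1 + r ^ 2) * ((1 + σ) ^ 2 + r ^ 2 * (1 - σ) ^ 2) ≤ B ^ 2) :
    ‖(!₂[1, -η] : Spinor)‖ * ‖(!₂[1 + σ * t, η * (1 - σ * t)] : Spinor)‖ ≤ B := by
  refine abs_le_of_sq_le_sq' ?_ hB |>.2
  have e1 : ‖(1 + σ * t : ℂ)‖ ^ 2 = (1 + σ * t) ^ 2 := by
    rw [← Complex.ofReal_one, ← Complex.ofReal_mul, ← Complex.ofReal_add, Complex.norm_real,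
      Real.norm_eq_abs, sq_abs]
  have e2 : ‖(1 - σ * t : ℂ)‖ ^ 2 = (1 - σ * t) ^ 2 := by
    rw [← Complex.ofReal_one, ← Complex.ofReal_mul, ← Complex.ofReal_sub, Complex.norm_real,
      Real.norm_eq_abs, sq_abs]
  rw [mul_pow, EuclideanSpace.norm_sq_eq, EuclideanSpace.norm_sq_eq, Fin.sum_univ_two,
    Fin.sum_univ_two]
  simp only [Matrix.cons_val_zero, Matrix.cons_val_one, norm_neg, norm_one, norm_mul, mul_pow,
    e1, e2, hr, one_pow]
  have h2 : (1 + σ * t) ^ 2 + r ^ 2 * (1 - σ * t) ^ 2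
      ≤ (1 - t) * (1 + r ^ 2) + t * ((1 + σ) ^ 2 + r ^ 2 * (1 - σ) ^ 2) := by
    have h3 : 0 ≤ t * (1 - t) := mul_nonneg ht.1 (sub_nonneg.2 ht.2)
    have h4 : (1 - t) * (1 + r ^ 2) + t * ((1 + σ) ^ 2 + r ^ 2 * (1 - σ) ^ 2)
        - ((1 + σ * t) ^ 2 + r ^ 2 * (1 - σ * t) ^ 2) = σ ^ 2 * (1 + r ^ 2) * (t * (1 - t)) := by
      ring
    have : 0 ≤ σ ^ 2 * (1 + r ^ 2) * (t * (1 - t)) := by positivity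
    linarith
  have h5 := mul_le_mul_of_nonneg_left h2 (by positivity : 0 ≤ 1 + r ^ 2)
  have h6 := mul_le_mul_of_nonneg_left h0 (sub_nonneg.2 ht.2)
  have h7 := mul_le_mul_of_nonneg_left h1 ht.1
  nlinarith

/-- The Green function on the imaginary axis. -/
theorem greenData_imaginary {m c σ t : ℝ} (hc : 0 < c) (hσ : σ ^ 2 = 1) (ht : t ≠ 0) :
    ∃ κ η, |t| / c ≤ κ ∧ GreenData m c (t * Complex.I) κ η σ (2 / c) := by
  set a := m * c ^ 2 with ha
  set s := Real.sqrt (a ^ 2 + t ^ 2) with hs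
  have hs2 : s ^ 2 = a ^ 2 + t ^ 2 := Real.sq_sqrt (by positivity)
  have hs0 : 0 < s := Real.sqrt_pos.2 (by positivity)
  have hw : (a : ℂ) + t * Complex.I ≠ 0 := fun h => ht (by simpa using congrArg Complex.im h)
  have hwn : ‖(a : ℂ) + t * Complex.I‖ = s := Complex.norm_add_mul_I a t
  have hη : ‖(s : ℂ) / (a + t * Complex.I)‖ = 1 := by
    rw [norm_div, hwn, Complex.norm_real, Real.norm_eq_abs, abs_of_pos hs0, div_self hs0.ne']
  have hcC : (c : ℂ) ≠ 0 := by exact_mod_cast hc.ne'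
  have hs2' : (s : ℂ) ^ 2 = a ^ 2 + t ^ 2 := by exact_mod_cast hs2
  refine ⟨s / c, (s : ℂ) / (a + t * Complex.I), ?_, ?_⟩
  · gcongr
    exact Real.abs_le_sqrt (by nlinarith)
  · refine ⟨hc, by positivity, by positivity, ?_, ?_, ?_, fun τ hτ => ?_⟩
    · rw [← norm_ne_zero_iff, hη]
      exact one_ne_zero
    · rw [← ha]
      push_cast
      field_simp
    · rw [← ha]
      push_cast
      field_simp
      linear_combination hs2' + t ^ 2 * Complex.I_sq
    · rw [hη]
      have e : 2 * 1 * c * (2 / c) = 4 := by field_simp; norm_num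
      rw [e]
      -- With `‖η‖ = 1` the endpoint values are `4` and `8`, both below `4² = 16`; `K` need not be
      -- sharp here.
      refine norm_one_neg_mul_norm_le hη hσ hτ (by norm_num) (by norm_num) ?_
      nlinarith

/-- The Green function in the spectral gap. -/
theorem greenData_real {m c σ x K : ℝ} (hc : 0 < c) (hσ : σ ^ 2 = 1) (hK : 0 ≤ K)
    (hx : |x| < m * c ^ 2)
    (h0 : (m * c ^ 2) ^ 2 ≤ (c * K) ^ 2 * ((m * c ^ 2) ^ 2 - x ^ 2))
    (h1 : 2 * (m * c ^ 2) ≤ (c * K) ^ 2 * (m * c ^ 2 - σ * x)) :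
    ∃ κ η, GreenData m c x κ η σ K := by
  set a := m * c ^ 2 with ha
  obtain ⟨hxl, hxr⟩ := abs_lt.1 hx
  have hp : 0 < a + x := by linarith
  have hq : 0 < a - x := by linarith
  set s := Real.sqrt (a ^ 2 - x ^ 2) with hs
  have hpq : 0 < a ^ 2 - x ^ 2 := by nlinarith
  have hs2 : s ^ 2 = a ^ 2 - x ^ 2 := Real.sq_sqrt hpq.le
  have hs0 : 0 < s := Real.sqrt_pos.2 hpq
  set r := s / (a + x) with hr
  have hr0 : 0 < r := by positivity
  have hr2 : r ^ 2 * (a + x) = a - x := by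
    rw [hr, div_pow, hs2]
    field_simp
    ring
  have hηn : ‖(r : ℂ)‖ = r := by rw [Complex.norm_real, Real.norm_eq_abs, abs_of_pos hr0]
  refine ⟨s / c, r, hc, by positivity, hK, by exact_mod_cast hr0.ne', ?_, ?_, fun τ hτ => ?_⟩
  · rw [← ha]
    have : c * (s / c) = r * (a + x) := by rw [hr]; field_simp
    exact_mod_cast this
  · rw [← ha]
    have : c * (s / c) * r = a - x := by
      rw [← hr2, hr]
      field_simp
    exact_mod_cast this
  · rw [hηn]
    refine norm_one_neg_mul_norm_le hηn hσ hτ (by positivity) ?_ ?_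
    · refine le_of_mul_le_mul_right ?_ (sq_pos_of_pos hp)
      -- Substituting `r² = (a - x) / (a + x)` turns the bound at `t = 0` into `h0`, and the one at
      -- `t = 1` into `h1`.
      have e1 : (1 + r ^ 2) ^ 2 * (a + x) ^ 2 = 4 * a ^ 2 := by
        linear_combination ((1 + r ^ 2) * (a + x) + 2 * a) * hr2
      have e2 : (2 * r * c * K) ^ 2 * (a + x) ^ 2 = 4 * ((c * K) ^ 2 * (a ^ 2 - x ^ 2)) := by
        linear_combination 4 * (c * K) ^ 2 * (a + x) * hr2
      rw [e1, e2]
      linarith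
    · refine le_of_mul_le_mul_right ?_ hp
      have e1 : (1 + r ^ 2) * (a + x) = 2 * a := by linear_combination hr2
      rcases sq_eq_one_iff.1 hσ with h | h <;> subst h
      · have e2 : (2 * r * c * K) ^ 2 * (a + x) = 4 * ((c * K) ^ 2 * (a - x)) := by
          linear_combination 4 * (c * K) ^ 2 * hr2
        rw [e2, mul_right_comm, e1]
        linarith
      · have h2 := mul_le_mul_of_nonneg_left h1 (by positivity : 0 ≤ 4 * r ^ 2)
        rw [mul_right_comm, e1]
        linarith

/-- The two terms of the boundary condition vanish separately, so it holds for every `η`, and one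
`σ` serves all spectral parameters. -/
theorem opSpectrum_diracOperator_subset {m c α σ v : ℝ} (hc : 0 < c) (hσ : σ ^ 2 = 1)
    (hbc : (1 + σ) * Real.cos α = 0) (hbs : (1 - σ) * Real.sin α = 0)
    {V : ℝ → Matrix (Fin 2) (Fin 2) ℂ} (hV : IntegrableOn V (Ioi (0 : ℝ)))
    (hherm : ∀ᵐ x ∂(volume.restrict (Ioi (0 : ℝ))), (V x).IsHermitian)
    (hv : v = (∫ x in Ioi (0 : ℝ), ‖V x‖) / c) {z : ℂ}
    (hz : z ∈ opSpectrum (diracOperator m c α V)) :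
    ∃ x : ℝ, (x : ℂ) = z ∧ ¬ (|x| < m * c ^ 2 ∧
      v ^ 2 * (m * c ^ 2) ^ 2 < (m * c ^ 2) ^ 2 - x ^ 2 ∧
      v ^ 2 * (2 * (m * c ^ 2)) < m * c ^ 2 - σ * x) := by
  have hsym := diracOperator_symmetric (m := m) (c := c) (α := α) hherm
  have hbc' : ∀ η : ℂ, (1 + σ) * Real.cos α - (1 - σ) * Real.sin α * η = 0 := fun η => by
    have h1 : ((1 + σ) * Real.cos α : ℂ) = 0 := by exact_mod_cast hbc
    have h2 : ((1 - σ) * Real.sin α : ℂ) = 0 := by exact_mod_cast hbs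
    rw [h1, h2, zero_mul, sub_zero]
  by_cases him : z.im = 0
  · refine ⟨z.re, Complex.ext rfl him.symm, fun ⟨h1, h2, h3⟩ => hz (hsym.mem_opResolventSet ?_)⟩
    have hzre : ((z.re : ℝ) : ℂ) = z := Complex.ext rfl him.symm
    set x := z.re
    set a := m * c ^ 2 with ha
    have hv0 : 0 ≤ v := hv ▸ div_nonneg (integral_nonneg fun _ => norm_nonneg _) hc.le
    obtain ⟨hxl, hxr⟩ := abs_lt.1 h1
    have hpq : 0 < a ^ 2 - x ^ 2 := by nlinarith
    have hd : 0 < a - σ * x := by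
      rcases sq_eq_one_iff.1 hσ with h | h <;> rw [h] <;> linarith
    -- `M` is the smallest admissible `(c K)²`; then `K c v < 1` is exactly the pair `h2`, `h3`.
    set M := max (a ^ 2 / (a ^ 2 - x ^ 2)) (2 * a / (a - σ * x)) with hM
    have hM0 : 0 ≤ M := le_max_of_le_left (by positivity)
    have hcK : (c * (Real.sqrt M / c)) ^ 2 = M := by
      rw [mul_div_cancel₀ _ hc.ne', Real.sq_sqrt hM0]
    obtain ⟨κ, η, H⟩ := greenData_real (K := Real.sqrt M / c) hc hσ (by positivity) h1
      (by rw [hcK, ← div_le_iff₀ hpq]; exact le_max_left _ _)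
      (by rw [hcK, ← div_le_iff₀ hd]; exact le_max_right _ _)
    rw [hzre] at H
    refine H.subSurjective (hbc' η) hV (q := Real.sqrt M * v) ?_ fun y _ => ?_
    · have : v ^ 2 * M < 1 := by
        rw [hM, mul_max_of_nonneg _ _ (sq_nonneg v), max_lt_iff, ← mul_div_assoc,
          ← mul_div_assoc, div_lt_one hpq, div_lt_one hd]
        exact ⟨h2, h3⟩
      refine lt_of_pow_lt_pow_left₀ 2 zero_le_one ?_
      rw [mul_pow, Real.sq_sqrt hM0]
      linarith
    · rw [hv, div_mul_eq_mul_div, ← mul_div_assoc]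
      exact div_le_div_of_nonneg_right (mul_le_mul_of_nonneg_left
        (setIntegral_exp_mul_le H.κ_pos hV.norm (fun _ => norm_nonneg _) y)
        (Real.sqrt_nonneg M)) hc.le
  · exfalso
    obtain ⟨κ₀, hκ₀, hsmall⟩ := exists_forall_setIntegral_exp_mul_le hV.norm
      -- With `K = 2 / c`, the threshold `c / 4` yields the contraction constant `1 / 2`.
      (fun _ => norm_nonneg _) (show 0 < c / 4 by positivity)
    refine hz (hsym.mem_opResolventSet_of_im_ne_zero (t₀ := κ₀ * c) (fun t ht => ?_) him)
    have ht0 : t ≠ 0 := abs_pos.1 (lt_of_lt_of_le (by positivity) ht)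
    obtain ⟨κ, η, hκ, H⟩ := greenData_imaginary (m := m) hc hσ ht0
    refine H.subSurjective (hbc' η) hV (q := 1 / 2) (by norm_num) fun y _ => ?_
    have h1 := hsmall κ (((le_div_iff₀ hc).2 ht).trans hκ) y
    calc _ ≤ 2 / c * (c / 4) := by gcongr
      _ = 1 / 2 := by field_simp; norm_num

/-- Factor `v² = (1 - s) (1 + s)` with `s = √(1 - v²)`. -/
theorem one_sub_div_one_add_sqrt {v : ℝ} (hv : v ^ 2 ≤ 1) :
    1 - v ^ 2 / (1 + Real.sqrt (1 - v ^ 2)) = Real.sqrt (1 - v ^ 2) := by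
  have h1 := Real.sqrt_nonneg (1 - v ^ 2)
  have h2 : Real.sqrt (1 - v ^ 2) ^ 2 = 1 - v ^ 2 := Real.sq_sqrt (by linarith)
  field_simp
  linear_combination -h2

theorem gap_inequalities {a v s x : ℝ} (ha : 0 ≤ a) (hs : 0 ≤ s) (hs2 : s ^ 2 = 1 - v ^ 2)
    (hl : -(a * (1 - 2 * v ^ 2)) < x) (hr : x < a * s) :
    |x| < a ∧ v ^ 2 * a ^ 2 < a ^ 2 - x ^ 2 ∧ v ^ 2 * (2 * a) < a + x := by
  have ha0 : 0 < a := lt_of_le_of_ne ha fun h => by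
    rw [← h] at hl hr
    linarith
  have hs1 : s ≤ 1 := by nlinarith [sq_nonneg v]
  have h1 : -(a * s) < x := by
    -- Indeed `1 - 2 v² = 2 s² - 1`, and `0 ≤ s ≤ 1`.
    have : 1 - 2 * v ^ 2 ≤ s := by nlinarith
    nlinarith
  have h2 : |x| < a * s := abs_lt.2 ⟨h1, hr⟩
  have h3 : x ^ 2 < (a * s) ^ 2 := sq_lt_sq.2 (by rwa [abs_of_nonneg (by positivity : 0 ≤ a * s)])
  refine ⟨h2.trans_le (by nlinarith), ?_, by linarith⟩
  rw [mul_pow, hs2] at h3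
  linarith

end

theorem mainTheorem4 (m c : ℝ) (hm : 0 ≤ m) (hc : 0 < c)
    (V : ℝ → Matrix (Fin 2) (Fin 2) ℂ) (hV : IntegrableOn V (Ioi (0 : ℝ)))
    (hherm : ∀ᵐ x ∂(volume.restrict (Ioi (0 : ℝ))), (V x).IsHermitian)
    (v : ℝ) (hv : v = (∫ x in Ioi (0 : ℝ), ‖V x‖) / c) (hlt : v < Real.sqrt 3 / 2) :
    opSpectrum (diracOperator m c 0 V) ⊆
      (fun x : ℝ => (x : ℂ)) '' (Iic (-(m * c ^ 2 * (1 - 2 * v ^ 2))) ∪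
        Ici (m * c ^ 2 * (1 - v ^ 2 / (1 + Real.sqrt (1 - v ^ 2))))) ∧
    opSpectrum (diracOperator m c (Real.pi / 2) V) ⊆
      (fun x : ℝ => (x : ℂ)) '' (Iic (-(m * c ^ 2 * (1 - v ^ 2 / (1 + Real.sqrt (1 - v ^ 2))))) ∪
        Ici (m * c ^ 2 * (1 - 2 * v ^ 2))) ∧
    (0 < m →
      -(m * c ^ 2 * (1 - 2 * v ^ 2)) < m * c ^ 2 * (1 - v ^ 2 / (1 + Real.sqrt (1 - v ^ 2))) ∧
      (0 < v →
        m * c ^ 2 * (1 - 2 * v ^ 2) < m * c ^ 2 * (1 - v ^ 2 / (1 + Real.sqrt (1 - v ^ 2))))) := by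
  have hv0 : 0 ≤ v := hv ▸ div_nonneg (integral_nonneg fun _ => norm_nonneg _) hc.le
  have hv2 : v ^ 2 < 3 / 4 := by
    have h1 := pow_lt_pow_left₀ hlt hv0 two_ne_zero
    rw [div_pow, Real.sq_sqrt (by norm_num)] at h1
    linarith
  rw [one_sub_div_one_add_sqrt (by linarith)]
  have hs2 : Real.sqrt (1 - v ^ 2) ^ 2 = 1 - v ^ 2 := Real.sq_sqrt (by linarith)
  have hs := Real.sqrt_nonneg (1 - v ^ 2)
  have ha : 0 ≤ m * c ^ 2 := by positivity
  set s := Real.sqrt (1 - v ^ 2)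
  refine ⟨fun z hz => ?_, fun z hz => ?_, fun hm0 => ?_⟩
  · obtain ⟨x, rfl, hx⟩ := opSpectrum_diracOperator_subset (σ := -1) hc (by norm_num) (by simp)
      (by simp) hV hherm hv hz
    refine ⟨x, ?_, rfl⟩
    by_contra hcon
    simp only [mem_union, mem_Iic, mem_Ici, not_or, not_le] at hcon
    refine hx ?_
    have h := gap_inequalities ha hs hs2 hcon.1 hcon.2
    exact ⟨h.1, h.2.1, by linarith [h.2.2]⟩
  · obtain ⟨x, rfl, hx⟩ := opSpectrum_diracOperator_subset (σ := 1) hc (by norm_num) (by simp)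
      (by simp) hV hherm hv hz
    refine ⟨x, ?_, rfl⟩
    by_contra hcon
    simp only [mem_union, mem_Iic, mem_Ici, not_or, not_le] at hcon
    refine hx ?_
    -- The case `α = π / 2` mirrors `α = 0` under `x ↦ -x`.
    have h := gap_inequalities (x := -x) ha hs hs2 (by linarith) (by linarith)
    rw [abs_neg, neg_sq] at h
    exact ⟨h.1, h.2.1, by linarith [h.2.2]⟩
  -- This is `v² < 3 / 4`; it makes `2 s² + s - 1 = (2 s - 1) (s + 1)` positive.
  · have hs1 : 1 / 2 < s := by nlinarith
    refine ⟨?_, fun hvpos => ?_⟩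
    · rw [← mul_neg]
      exact mul_lt_mul_of_pos_left (by nlinarith) (by positivity)
    · refine mul_lt_mul_of_pos_left ?_ (by positivity)
      have : s < 1 := by nlinarith [sq_pos_of_pos hvpos]
      nlinarith
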